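/- Let $n\ge 2$. For $c\ge 0$ let $X=[c,c+1]^n$ be the type space of a unit-demand buyer whose $n$ item values are i.i.d. $U[c,c+1]$, with distribution function $G$. Write $\max(x)=\max_i x_i$. Let $\mathcal U(X)$ be the set of continuous, coordinatewise non-decreasing, convex functions $u:X\to\mathbb R$. Let $p=p(c)$ be the maximizer of the revenue $q\,(1-G(q)^n)$ over $q\in[c,c+1]$. Let $c^*$ be the solution $c\in(0,n)$ of $(n+1)(c+1-p(c))=c+1$. Let $\mu=\mu_+-\mu_-$ be the Jordan decomposition of the signed measure $\mu$ on $X$ that is the sum of: a point mass $+1$ at $(c,\dots,c)$; a mass $-(n+1)$ distributed uniformly on $X$; for each $i$, a mass $+(c+1)$ distributed uniformly on the face $\{x\in X: x_i=c+1\}$; and, for each $i$, a mass $-c$ distributed uniformly on the face $\{x\in X: x_i=c\}$. Let $B=\{x\in X:\max(x)=c+1\}$ and $u^*(x)=\max\{\max(x)-p,0\}$. A set $U\subset B$ is an upper set of $B$ if $x\in U$, $x'\in B$ and $x\le x'$ imply $x'\in U$; for such $U$ let $$\mathrm{push}(U)=\{y\in X:\ \max(y)\ge p,\ u^*(x)-u^*(y)=\|x-y\|_\infty\text{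 for some }x\in U\}.$$ Let $\gamma_1$ be the measure on $B$ with $\gamma_1(U)=\mu_-(\mathrm{push}(U))$ for every measurable upper set $U$ of $B$. Then $p(c)$ (for every $c\ge0$), $c^*$ and $\gamma_1$ exist and are unique, and for every $c\ge 0$ $$\gamma_1\succeq_{\mathrm{cvx}}\mu_+|_B\iff c\in[0,c^*],$$ where the left-hand side means $\int_B u\,d\gamma_1\ge\int_B u\,d\mu_+$ for all $u\in\mathcal U(X)$. -/

import Mathlib

open MeasureTheory Set

noncomputable section

namespace UniformPricing

/-! ### The model: `n` items whose values are i.i.d. uniform on `[c, c + 1]` -/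

/-- The uniform distribution `U[c, c+1]`. -/
def uniformLaw (c : ℝ) : Measure ℝ :=
  ProbabilityTheory.cond volume (Icc c (c + 1))

/-- The type space `X = [c, c+1]^n`. -/
def typeSpace (n : ℕ) (c : ℝ) : Set (Fin n → ℝ) :=
  Icc (fun _ => c) (fun _ => c + 1)

/-- The joint law of the `n` independent values (density `1` on `X`). -/
def valueLaw (n : ℕ) (c : ℝ) : Measure (Fin n → ℝ) :=
  Measure.pi fun _ => uniformLaw c

/-- `p` is a price of the grand bundle, within `[c, c+1]`, which maximizes the expected revenue
`q (1 - G(q)^n)`, where `G` is the cumulative distribution function of `U[c, c+1]`. -/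
def IsOptimalPrice (n : ℕ) (c p : ℝ) : Prop :=
  p ∈ Icc c (c + 1) ∧
    IsMaxOn (fun q : ℝ => q * (1 - ProbabilityTheory.cdf (uniformLaw c) q ^ n))
      (Icc c (c + 1)) p

/-- `s` solves the threshold equation `(n + 1) (s + 1 - p(s)) = s + 1` in `(0, n)`, with `p(s)` an
optimal price of the grand bundle for `U[s, s+1]`. -/
def IsThreshold (n : ℕ) (s : ℝ) : Prop :=
  s ∈ Ioo (0 : ℝ) n ∧ ∃ p, IsOptimalPrice n s p ∧ ((n : ℝ) + 1) * (s + 1 - p) = s + 1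

/-! ### The transformed measure -/

instance instIsProbabilityMeasureUniformLaw (c : ℝ) : IsProbabilityMeasure (uniformLaw c) :=
  ProbabilityTheory.cond_isProbabilityMeasure_of_finite (by simp [Real.volume_Icc])
    (by simp [Real.volume_Icc])

instance instIsProbabilityMeasureValueLaw (n : ℕ) (c : ℝ) : IsProbabilityMeasure (valueLaw n c) := by
  unfold valueLaw; infer_instance

/-- Unit mass distributed uniformly on the face `{x | x i = a}` (`a = c` or `a = c + 1`) of the unit
cube `X`: the `i`-th coordinate is `a`, the others are independent and uniform on `[c, c+1]`.
It is the surface measure of that face. -/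
def faceMeasure (n : ℕ) (c : ℝ) (i : Fin n) (a : ℝ) : Measure (Fin n → ℝ) :=
  (valueLaw n c).map fun x => Function.update x i a

instance instIsFiniteMeasureFaceMeasure (n : ℕ) (c : ℝ) (i : Fin n) (a : ℝ) :
    IsFiniteMeasure (faceMeasure n c i a) := by
  unfold faceMeasure; infer_instance

/-- The transformed measure
`μ(E) = 1_E(c, …, c) + ∫_{∂X} 1_E(x) (x · n̂) dx - (n + 1) ∫_X 1_E(x) dx`.
On the face `x i = c + 1` one has `x · n̂ = c + 1`, on the face `x i = c` one has `x · n̂ = -c`. -/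
def transformedMeasure (n : ℕ) (c : ℝ) : SignedMeasure (Fin n → ℝ) :=
  (Measure.dirac (fun _ : Fin n => c)).toSignedMeasure
    + ∑ i : Fin n, ((c + 1) • (faceMeasure n c i (c + 1)).toSignedMeasure
        - c • (faceMeasure n c i c).toSignedMeasure)
    - ((n : ℝ) + 1) • (valueLaw n c).toSignedMeasure

/-- The positive part `μ₊` of the transformed measure. -/
def muPlus (n : ℕ) (c : ℝ) : Measure (Fin n → ℝ) :=
  (transformedMeasure n c).toJordanDecomposition.posPart

/-- The negative part `μ₋` of the transformed measure. -/
def muMinus (n : ℕ) (c : ℝ) : Measure (Fin n → ℝ) :=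
  (transformedMeasure n c).toJordanDecomposition.negPart

/-! ### The pushed measure -/

/-- The largest coordinate of `x`. -/
def maxCoord {n : ℕ} (x : Fin n → ℝ) : ℝ := ⨆ i, x i

/-- The buyer's utility under uniform pricing, `u*(x) = max {max(x) - p, 0}`. -/
def uniformPricingUtility {n : ℕ} (p : ℝ) (x : Fin n → ℝ) : ℝ := max (maxCoord x - p) 0

/-- `W = {x ∈ X | max(x) ∈ (p, c+1]}`. -/
def regionW (n : ℕ) (c p : ℝ) : Set (Fin n → ℝ) :=
  {x ∈ typeSpace n c | maxCoord x ∈ Ioc p (c + 1)}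

/-- `B_Z = {x ∈ X | max(x) = p}`. -/
def regionBZ (n : ℕ) (c p : ℝ) : Set (Fin n → ℝ) :=
  {x ∈ typeSpace n c | maxCoord x = p}

/-- `B = {x ∈ X | max(x) = c + 1}`. -/
def regionB (n : ℕ) (c : ℝ) : Set (Fin n → ℝ) :=
  {x ∈ typeSpace n c | maxCoord x = c + 1}

/-- `U ⊆ E` is an upper set with respect to `E`. -/
def IsUpperIn {n : ℕ} (E U : Set (Fin n → ℝ)) : Prop :=
  U ⊆ E ∧ ∀ x ∈ U, ∀ x' ∈ E, x ≤ x' → x' ∈ U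

/-- The pushed set: all `y ∈ W ∪ B_Z` such that `u*(x) - u*(y) = ‖x - y‖_∞` for some `x ∈ U ∩ B`
(the norm of `Fin n → ℝ` is the sup norm). -/
def push (n : ℕ) (c p : ℝ) (U : Set (Fin n → ℝ)) : Set (Fin n → ℝ) :=
  {y ∈ regionW n c p ∪ regionBZ n c p | ∃ x ∈ U ∩ regionB n c,
    uniformPricingUtility p x - uniformPricingUtility p y = ‖x - y‖}

/-- `ν` is a measure on `B` with `ν(U) = μ₋(push(U))` for every measurable upper set `U ⊆ B`. -/
def IsPushedMeasure (n : ℕ) (c p : ℝ) (ν : Measure (Fin n → ℝ)) : Prop :=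
  ν (regionB n c)ᶜ = 0 ∧
    ∀ U : Set (Fin n → ℝ), MeasurableSet U → IsUpperIn (regionB n c) U →
      ν U = muMinus n c (push n c p U)

/-! ### Convex dominance -/

/-- `𝓤(X)`: the continuous, non-decreasing, convex functions on `X`. -/
def testFunctions {n : ℕ} (X : Set (Fin n → ℝ)) : Set ((Fin n → ℝ) → ℝ) :=
  {u | ContinuousOn u X ∧ MonotoneOn u X ∧ ConvexOn ℝ X u}

/-- `α|_E ⪰_cvx β|_E`: `∫_E u dα ≥ ∫_E u dβ` for all `u ∈ 𝓤(X)`, where `E ⊆ X`. -/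
def ConvexDominatesOn {n : ℕ} (X E : Set (Fin n → ℝ)) (α β : Measure (Fin n → ℝ)) : Prop :=
  ∀ u ∈ testFunctions X, ∫ x in E, u x ∂α ≥ ∫ x in E, u x ∂β

end UniformPricing

end

/-!
With `n` items, write `a = p - c`. The revenue `(c + a) (1 - a ^ n)` is strictly concave in
`a`, so the optimal price is unique and given by the first-order condition
`(n + 1) a ^ n + n c a ^ (n - 1) = 1` (`isOptimalPrice_iff`).

The diagonal shift `T y = y + (c + 1 - max y) (1, …, 1)` maps the type space to `B`. A type `y` with
`max y ≥ p` belongs to the push of an upper set `U` exactly if `T y ∈ U` (`push_eq`), and the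
measurable upper sets determine a finite measure. Hence the pushed measure exists, is unique, and is
the image under `T` of `μ₋` restricted to `max y ≥ p` (`isPushedMeasure_iff`).

For a continuous `u` let `f` be its restriction to the face `x i = c + 1`, in the coordinates
`w = c + 1 - x` on `[0, 1] ^ (n - 1)`, and let `A q` be the integral of `f` over `[0, q] ^ (n - 1)`.
The type space is cut into the cones on which a given coordinate is the largest; the parts of `μ₋`
carried by the interior and by the bottom faces are moved to the top faces by Fubini, a reflection
of `[0, q] ^ (n - 1)`, and a bijection on the ordered pairs of distinct coordinates. The outcome is
that `∫ u dγ₁ - ∫ u dμ₊` over `B` is the sum over the faces of `(n + 1) ∫_a^1 A - A 1 - c A a`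
(`integral_pushedMeasure_sub_integral_muPlus`).

If `c + 1 ≤ (n + 1) (1 - a)`, every summand is nonnegative as soon as `u` is non-decreasing, so that
`f` is decreasing (`cubeIntegral_comparison`). If `c + 1 > (n + 1) (1 - a)`, take a convex `u`
supported so close to the corner `(c + 1, …, c + 1)` that `A` is a positive constant on `[a, 1]`:
then every summand is `A ((n + 1) (1 - a) - (c + 1)) < 0` (`le_of_convexDominatesOn`).

Finally, `c + 1 ≤ (n + 1) (1 - a)` means `a ≤ (n - c) / (n + 1)`. For `c ≤ n`, as the left-hand side
of the first-order condition increases in `a`, this is the inequality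
`(n - c) ^ (n - 1) (n + (n - 1) c) ≥ (n + 1) ^ (n - 1)`, whose left-hand side decreases strictly in
`c` on `[0, n]`; for `c > n` it fails. So the inequality holds exactly up to the threshold
(`le_threshold_iff`).

Where a lemma needs `n ≥ 2`, the number of items is mostly written as `e + 2`.
-/

namespace UniformPricing

/-! ### The optimal price -/

/-- A power lies strictly above its tangent lines. -/
theorem tangent_lt_pow {a x : ℝ} (ha : 0 < a) (hx : 0 ≤ x) (hxa : x ≠ a) (m : ℕ) :
    a ^ (m + 2) + (m + 2) * a ^ (m + 1) * (x - a) < x ^ (m + 2) := by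
  have hsq : 0 < (x - a) ^ 2 := by
    have := sub_ne_zero.2 hxa
    positivity
  induction m with
  | zero => norm_num; nlinarith
  | succ m ih =>
    have h1 : 0 ≤ x * (x ^ (m + 2) - (a ^ (m + 2) + (m + 2) * a ^ (m + 1) * (x - a))) :=
      mul_nonneg hx (sub_pos.2 ih).le
    have h2 : 0 < ((m : ℝ) + 2) * a ^ (m + 1) * (x - a) ^ 2 := by positivity
    push_cast
    linear_combination h1 + h2

theorem uniformLaw_eq (c : ℝ) : uniformLaw c = volume.restrict (Icc c (c + 1)) := by
  simp [uniformLaw, ProbabilityTheory.cond, Real.volume_Icc]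

theorem cdf_uniformLaw {c q : ℝ} (hq : q ∈ Icc c (c + 1)) :
    ProbabilityTheory.cdf (uniformLaw c) q = q - c := by
  have h : Iic q ∩ Icc c (c + 1) = Icc c q := by
    ext x; simp only [mem_inter_iff, mem_Iic, mem_Icc]
    constructor
    · rintro ⟨h1, h2, -⟩; exact ⟨h2, h1⟩
    · rintro ⟨h1, h2⟩; exact ⟨h2, h1, h2.trans hq.2⟩
  rw [ProbabilityTheory.cdf_eq_real, uniformLaw_eq, measureReal_restrict_apply measurableSet_Iic, h,
    Real.volume_real_Icc_of_le hq.1]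

/-- The left-hand side of the first-order condition `margin e c a = 1` for the price `c + a`
when there are `e + 2` items. -/
noncomputable def margin (e : ℕ) (c a : ℝ) : ℝ :=
  ((e : ℝ) + 3) * a ^ (e + 2) + ((e : ℝ) + 2) * c * a ^ (e + 1)

theorem margin_strictMonoOn (e : ℕ) {c : ℝ} (hc : 0 ≤ c) : StrictMonoOn (margin e c) (Ici 0) := by
  intro x hx y _ hxy
  have hx' : 0 ≤ x := hx
  have h1 : x ^ (e + 2) < y ^ (e + 2) := pow_lt_pow_left₀ hxy hx (by omega)
  have h2 : x ^ (e + 1) ≤ y ^ (e + 1) := pow_le_pow_left₀ hx hxy.le _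
  have h3 := mul_le_mul_of_nonneg_left h2 (show 0 ≤ ((e : ℝ) + 2) * c by positivity)
  have h4 := mul_lt_mul_of_pos_left h1 (show 0 < (e : ℝ) + 3 by positivity)
  exact add_lt_add_of_lt_of_le h4 h3

theorem exists_margin_eq_one (e : ℕ) {c : ℝ} (hc : 0 ≤ c) :
    ∃ a ∈ Ioo (0 : ℝ) 1, margin e c a = 1 := by
  have hcont : ContinuousOn (margin e c) (Icc 0 1) := by unfold margin; fun_prop
  have h0 : margin e c 0 = 0 := by simp [margin]
  have h1 : 1 < margin e c 1 := by
    simp only [margin, one_pow, mul_one]; nlinarith [(Nat.cast_nonneg e : (0 : ℝ) ≤ e)]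
  obtain ⟨a, ha, h⟩ := intermediate_value_Ioo zero_le_one hcont
    (show (1 : ℝ) ∈ Ioo _ _ by rw [h0]; exact ⟨one_pos, h1⟩)
  exact ⟨a, ha, h⟩

/-- The revenue at a solution of the first-order condition exceeds all others: both powers in the
expanded revenue lie above their tangents, and the slopes cancel. -/
theorem revenue_lt {e : ℕ} {c a x : ℝ} (hc : 0 ≤ c) (ha : 0 < a) (h : margin e c a = 1) (hx : 0 ≤ x)
    (hxa : x ≠ a) : (c + x) * (1 - x ^ (e + 2)) < (c + a) * (1 - a ^ (e + 2)) := by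
  have h1 := tangent_lt_pow ha hx hxa (e + 1)
  have h2 := mul_le_mul_of_nonneg_left (tangent_lt_pow ha hx hxa e).le hc
  unfold margin at h
  push_cast at h1
  linear_combination h1 + h2 + (a - x) * h

theorem isOptimalPrice_iff {e : ℕ} {c p : ℝ} (hc : 0 ≤ c) :
    IsOptimalPrice (e + 2) c p ↔ p - c ∈ Ioo (0 : ℝ) 1 ∧ margin e c (p - c) = 1 := by
  have key : ∀ a ∈ Ioo (0 : ℝ) 1, margin e c a = 1 → ∀ q ∈ Icc c (c + 1), q ≠ c + a →
      q * (1 - ProbabilityTheory.cdf (uniformLaw c) q ^ (e + 2)) <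
        (c + a) * (1 - ProbabilityTheory.cdf (uniformLaw c) (c + a) ^ (e + 2)) := by
    intro a ha h q hq hne
    rw [cdf_uniformLaw hq, cdf_uniformLaw ⟨by linarith [ha.1], by linarith [ha.2]⟩]
    have := revenue_lt hc ha.1 h (sub_nonneg.2 hq.1) (fun h' => hne (by linarith))
    simpa using this
  constructor
  · rintro ⟨hp, hmax⟩
    obtain ⟨a, ha, h⟩ := exists_margin_eq_one e hc
    have hpa : p = c + a := by
      by_contra hne
      exact absurd (hmax (show c + a ∈ Icc c (c + 1) from ⟨by linarith [ha.1], by linarith [ha.2]⟩))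
        (not_le_of_gt (key a ha h p hp hne))
    rw [hpa, add_sub_cancel_left]
    exact ⟨ha, h⟩
  · rintro ⟨ha, h⟩
    refine ⟨⟨by linarith [ha.1], by linarith [ha.2]⟩, fun q hq => ?_⟩
    have := key _ ha h q hq
    rw [add_sub_cancel] at this
    rcases eq_or_ne q p with rfl | hne
    · exact le_refl (α := ℝ) _
    · exact (this hne).le

theorem existsUnique_isOptimalPrice (e : ℕ) {c : ℝ} (hc : 0 ≤ c) :
    ∃! p : ℝ, IsOptimalPrice (e + 2) c p := by
  obtain ⟨a, ha, h⟩ := exists_margin_eq_one e hc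
  refine ⟨c + a, (isOptimalPrice_iff hc).2 (by simpa using ⟨ha, h⟩), fun p hp => ?_⟩
  obtain ⟨hp1, hp2⟩ := (isOptimalPrice_iff hc).1 hp
  have : p - c = a := (margin_strictMonoOn e hc).injOn (mem_Ici.2 hp1.1.le) (mem_Ici.2 ha.1.le) (hp2.trans h.symm)
  linarith

/-! ### The threshold -/

/-- Up to normalization, the left-hand side of the first-order condition `margin e c a = 1` at
`a = (n - c) / (n + 1)`, where `n = e + 2`; this value of `a` solves `(n + 1) (1 - a) = c + 1`. -/
noncomputable def thresholdPoly (e : ℕ) (c : ℝ) : ℝ :=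
  ((e : ℝ) + 2 - c) ^ (e + 1) * ((e : ℝ) + 2 + ((e : ℝ) + 1) * c)

theorem thresholdPoly_strictAntiOn (e : ℕ) :
    StrictAntiOn (thresholdPoly e) (Icc 0 ((e : ℝ) + 2)) := by
  refine strictAntiOn_of_deriv_neg (convex_Icc _ _) (by unfold thresholdPoly; fun_prop) ?_
  intro c hc
  rw [interior_Icc] at hc
  have h : HasDerivAt (thresholdPoly e)
      ((((e + 1 : ℕ) : ℝ) * ((e : ℝ) + 2 - c) ^ e * (-1)) * ((e : ℝ) + 2 + ((e : ℝ) + 1) * c)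
        + ((e : ℝ) + 2 - c) ^ (e + 1) * (((e : ℝ) + 1) * 1)) c :=
    (((hasDerivAt_id c).const_sub _).pow (e + 1)).mul
      (((hasDerivAt_id c).const_mul ((e : ℝ) + 1)).const_add _)
  rw [h.deriv]
  have h1 : 0 < ((e : ℝ) + 1) * ((e : ℝ) + 2 - c) ^ e * (((e : ℝ) + 2) * c) := by
    have := hc.1
    have : 0 < (e : ℝ) + 2 - c := by linarith [hc.2]
    positivity
  push_cast
  linear_combination h1

theorem margin_threshold (e : ℕ) (c : ℝ) :
    margin e c (((e : ℝ) + 2 - c) / ((e : ℝ) + 3)) =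
      thresholdPoly e c / ((e : ℝ) + 3) ^ (e + 1) := by
  have : (e : ℝ) + 3 ≠ 0 := by positivity
  unfold margin thresholdPoly
  rw [div_pow, div_pow]
  field_simp
  ring

theorem pow_lt_thresholdPoly_zero (e : ℕ) : ((e : ℝ) + 3) ^ (e + 1) < thresholdPoly e 0 := by
  have h3 : (0 : ℝ) < (e : ℝ) + 3 := by positivity
  -- Bernoulli's inequality bounds `(n / (n + 1)) ^ (n - 1)` below by `2 / (n + 1)`.
  have hb : -2 ≤ -(1 / ((e : ℝ) + 3)) := by
    have : 1 / ((e : ℝ) + 3) ≤ 1 := by rw [div_le_one h3]; linarith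
    linarith
  have h := one_add_mul_le_pow hb (e + 1)
  have h4 : 1 + -(1 / ((e : ℝ) + 3)) = ((e : ℝ) + 2) / ((e : ℝ) + 3) := by field_simp; ring
  rw [h4, div_pow, le_div_iff₀ (by positivity)] at h
  have h5 : 1 + ((e + 1 : ℕ) : ℝ) * -(1 / ((e : ℝ) + 3)) = 2 / ((e : ℝ) + 3) := by
    push_cast; field_simp; ring
  rw [h5] at h
  simp only [thresholdPoly, sub_zero, mul_zero, add_zero]
  refine lt_of_lt_of_le ?_ (mul_le_mul_of_nonneg_right h (by positivity))
  have h6 : 1 < 2 / ((e : ℝ) + 3) * ((e : ℝ) + 2) := by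
    rw [div_mul_eq_mul_div, lt_div_iff₀ h3]; linarith
  have := mul_lt_mul_of_pos_left h6 (pow_pos h3 (e + 1))
  linarith

theorem exists_threshold (e : ℕ) :
    ∃ s ∈ Ioo (0 : ℝ) ((e : ℝ) + 2), thresholdPoly e s = ((e : ℝ) + 3) ^ (e + 1) := by
  have h0 : thresholdPoly e ((e : ℝ) + 2) = 0 := by simp [thresholdPoly]
  obtain ⟨s, hs, h⟩ := intermediate_value_Ioo' (show (0 : ℝ) ≤ (e : ℝ) + 2 by positivity)
    (show ContinuousOn (thresholdPoly e) _ by unfold thresholdPoly; fun_prop)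
    (show ((e : ℝ) + 3) ^ (e + 1) ∈ Ioo _ _ from
      ⟨by rw [h0]; positivity, pow_lt_thresholdPoly_zero e⟩)
  exact ⟨s, hs, h⟩

theorem isThreshold_iff {e : ℕ} {t : ℝ} (ht : t ∈ Ioo (0 : ℝ) ((e : ℝ) + 2))
    (h : thresholdPoly e t = ((e : ℝ) + 3) ^ (e + 1)) (s : ℝ) :
    IsThreshold (e + 2) s ↔ s = t := by
  have h3 : (0 : ℝ) < (e : ℝ) + 3 := by positivity
  unfold IsThreshold
  push_cast
  constructor
  · rintro ⟨hs, p, hp, heq⟩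
    obtain ⟨-, hp2⟩ := (isOptimalPrice_iff hs.1.le).1 hp
    have : p - s = ((e : ℝ) + 2 - s) / ((e : ℝ) + 3) := by
      rw [eq_div_iff h3.ne']; linarith
    rw [this, margin_threshold, div_eq_one_iff_eq (by positivity)] at hp2
    exact (thresholdPoly_strictAntiOn e).injOn ⟨hs.1.le, hs.2.le⟩ ⟨ht.1.le, ht.2.le⟩
      (hp2.trans h.symm)
  · rintro rfl
    refine ⟨ht, s + ((e : ℝ) + 2 - s) / ((e : ℝ) + 3), (isOptimalPrice_iff ht.1.le).2 ?_, ?_⟩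
    · rw [add_sub_cancel_left, margin_threshold, h, div_self (by positivity)]
      refine ⟨⟨div_pos (by linarith [ht.2]) h3, ?_⟩, rfl⟩
      rw [div_lt_one h3]; linarith [ht.1]
    · field_simp
      ring

/-- At a price `c + a` satisfying the first-order condition, the threshold inequality
`c + 1 ≤ (n + 1) (1 - a)`, where `n = e + 2`, says that `c` does not exceed the threshold. -/
theorem le_threshold_iff {e : ℕ} {t c a : ℝ} (ht : t ∈ Ioo (0 : ℝ) ((e : ℝ) + 2))
    (h : thresholdPoly e t = ((e : ℝ) + 3) ^ (e + 1)) (hc : 0 ≤ c) (ha : 0 < a)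
    (hm : margin e c a = 1) : c + 1 ≤ ((e : ℝ) + 3) * (1 - a) ↔ c ≤ t := by
  have h3 : (0 : ℝ) < (e : ℝ) + 3 := by positivity
  have hiff : c + 1 ≤ ((e : ℝ) + 3) * (1 - a) ↔ a ≤ ((e : ℝ) + 2 - c) / ((e : ℝ) + 3) := by
    rw [le_div_iff₀ h3]
    constructor <;> intro h' <;> linarith
  rw [hiff]
  rcases lt_or_ge ((e : ℝ) + 2) c with hlt | hle
  · have : ((e : ℝ) + 2 - c) / ((e : ℝ) + 3) < 0 := div_neg_of_neg_of_pos (by linarith) h3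
    constructor <;> intro h'
    · linarith
    · linarith [ht.2]
  · have hb : 0 ≤ ((e : ℝ) + 2 - c) / ((e : ℝ) + 3) := div_nonneg (by linarith) h3.le
    rw [← (margin_strictMonoOn e hc).le_iff_le (mem_Ici.2 ha.le) (mem_Ici.2 hb), hm, margin_threshold,
      le_div_iff₀ (by positivity), one_mul, ← h,
      (thresholdPoly_strictAntiOn e).le_iff_ge ⟨ht.1.le, ht.2.le⟩ ⟨hc, hle⟩]

/-! ### Integration over cubes -/

theorem integral_eq_integral_insertNth {m : ℕ} (k : Fin (m + 1)) {F : (Fin (m + 1) → ℝ) → ℝ}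
    (hF : Integrable F) : ∫ y, F y = ∫ q : ℝ, ∫ w : Fin m → ℝ, F (k.insertNth q w) := by
  have hmp := (volume_preserving_piFinSuccAbove (fun _ : Fin (m + 1) => ℝ) k).symm
  rw [← hmp.integral_comp' F, Measure.volume_eq_prod, integral_prod]
  · rfl
  · exact (hmp.integrable_comp_emb (MeasurableEquiv.measurableEmbedding _)).2 hF

theorem volume_setOf_eq_eq_zero {m : ℕ} {k l : Fin m} (h : k ≠ l) :
    volume {y : Fin m → ℝ | y k = y l} = 0 := by
  let s : Submodule ℝ (Fin m → ℝ) :=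
    LinearMap.ker (LinearMap.proj (R := ℝ) (φ := fun _ => ℝ) k - LinearMap.proj l)
  have hs : s ≠ ⊤ := by
    intro hs
    have : Pi.single k (1 : ℝ) ∈ s := hs ▸ Submodule.mem_top
    simp [s, LinearMap.mem_ker, h.symm] at this
  convert Measure.addHaar_submodule volume s hs using 2
  ext y
  simp [s, LinearMap.mem_ker, sub_eq_zero]

theorem measurableSet_cone {m : ℕ} (k : Fin m) :
    MeasurableSet {y : Fin m → ℝ | ∀ l, y l ≤ y k} := by
  rw [ofPred_forall]
  exact MeasurableSet.iInter fun l => measurableSet_le (measurable_pi_apply l) (measurable_pi_apply k)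

/-- Decomposition of the unit cube into the cones on which a given coordinate is the largest. -/
theorem setIntegral_cube_eq_sum_cone {m : ℕ} {F : (Fin (m + 1) → ℝ) → ℝ}
    (hF : IntegrableOn F (Icc 0 1)) :
    ∫ y in Icc 0 1, F y =
      ∑ k : Fin (m + 1), ∫ q in Icc (0 : ℝ) 1, ∫ w in Icc (0 : Fin m → ℝ) (fun _ => q),
        F (k.insertNth q w) := by
  -- The cones overlap only in hyperplanes `y k = y l`.
  let C : Fin (m + 1) → Set (Fin (m + 1) → ℝ) := fun k => Icc 0 1 ∩ {y | ∀ l, y l ≤ y k}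
  have hC : ∀ k, MeasurableSet (C k) := fun k => measurableSet_Icc.inter (measurableSet_cone k)
  have hU : ⋃ k, C k = Icc 0 1 := by
    rw [← inter_iUnion, inter_eq_left]
    intro y _
    obtain ⟨k, hk⟩ := Finite.exists_max y
    exact mem_iUnion.2 ⟨k, hk⟩
  have hd : Pairwise (Function.onFun (AEDisjoint volume) C) := fun k l hkl =>
    measure_mono_null (fun y hy => le_antisymm (hy.2.2 k) (hy.1.2 l)) (volume_setOf_eq_eq_zero hkl)
  rw [← hU, integral_iUnion_ae (fun k => (hC k).nullMeasurableSet) hd (by rwa [hU]), tsum_fintype]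
  refine Finset.sum_congr rfl fun k _ => ?_
  have hint : Integrable ((C k).indicator F) :=
    (integrable_indicator_iff (hC k)).2 (hF.mono_set inter_subset_left)
  rw [← integral_indicator (hC k), integral_eq_integral_insertNth k hint,
    ← integral_indicator measurableSet_Icc]
  refine integral_congr_ae (Filter.Eventually.of_forall fun q => ?_)
  have hmem : ∀ w : Fin m → ℝ, k.insertNth q w ∈ C k ↔
      q ∈ Icc (0 : ℝ) 1 ∧ w ∈ Icc (0 : Fin m → ℝ) (fun _ => q) := by
    intro w
    simp only [C, mem_inter_iff, mem_Icc, Pi.le_def, mem_ofPred_eq, Fin.forall_iff_succAbove k,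
      Fin.insertNth_apply_same, Fin.insertNth_apply_succAbove, Pi.zero_apply, Pi.one_apply]
    constructor
    · rintro ⟨⟨⟨h1, h2⟩, h3, h4⟩, -, h5⟩
      exact ⟨⟨h1, h3⟩, h2, h5⟩
    · rintro ⟨⟨h1, h3⟩, h2, h5⟩
      exact ⟨⟨⟨h1, h2⟩, h3, fun j => (h5 j).trans h3⟩, le_rfl, h5⟩
  by_cases hq : q ∈ Icc (0 : ℝ) 1
  · rw [indicator_of_mem hq, ← integral_indicator measurableSet_Icc]
    refine integral_congr_ae (Filter.Eventually.of_forall fun w => ?_)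
    by_cases hw : w ∈ Icc (0 : Fin m → ℝ) (fun _ => q)
    · simp only [indicator_of_mem hw, indicator_of_mem ((hmem w).2 ⟨hq, hw⟩)]
    · simp only [indicator_of_notMem hw, indicator_of_notMem fun h => hw ((hmem w).1 h).2]
  · rw [indicator_of_notMem hq]
    simp only [indicator_of_notMem fun h => hq ((hmem _).1 h).1, integral_zero]

/-- The integral of `f` over the cube `[0, q]^m`. -/
noncomputable def cubeIntegral {m : ℕ} (f : (Fin m → ℝ) → ℝ) (q : ℝ) : ℝ :=
  ∫ w in Icc (0 : Fin m → ℝ) (fun _ => q), f w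

theorem cubeIntegral_reflect {m : ℕ} (f : (Fin m → ℝ) → ℝ) (q : ℝ) :
    cubeIntegral (fun w => f ((fun _ => q) - w)) q = cubeIntegral f q := by
  unfold cubeIntegral
  rw [← integral_indicator measurableSet_Icc, ← integral_indicator measurableSet_Icc,
    ← integral_sub_left_eq_self _ volume (fun _ => q)]
  congr 1
  ext w
  have : (fun _ => q) - w ∈ Icc (0 : Fin m → ℝ) (fun _ => q) ↔ w ∈ Icc 0 (fun _ => q) := by
    simp [Pi.le_def, and_comm]
  by_cases hw : w ∈ Icc (0 : Fin m → ℝ) (fun _ => q)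
  · rw [indicator_of_mem hw, indicator_of_mem (this.2 hw), sub_sub_cancel]
  · rw [indicator_of_notMem hw, indicator_of_notMem (mt this.1 hw)]

theorem cubeIntegral_add {m : ℕ} {f g : (Fin m → ℝ) → ℝ} {q : ℝ}
    (hf : IntegrableOn f (Icc 0 (fun _ => q))) (hg : IntegrableOn g (Icc 0 (fun _ => q))) :
    cubeIntegral (f + g) q = cubeIntegral f q + cubeIntegral g q :=
  integral_add hf hg

open scoped Pointwise in
theorem smul_cube {m : ℕ} {q : ℝ} (hq : 0 < q) :
    q • Icc (0 : Fin m → ℝ) (fun _ => 1) = Icc 0 (fun _ => q) := by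
  ext w
  rw [mem_smul_set_iff_inv_smul_mem₀ hq.ne']
  simp only [mem_Icc, Pi.le_def, Pi.zero_apply, Pi.smul_apply, smul_eq_mul]
  refine and_congr (forall_congr' fun i => ?_) (forall_congr' fun i => ?_)
  · constructor
    · intro h
      simpa [hq.ne'] using mul_nonneg hq.le h
    · intro h
      positivity
  · rw [inv_mul_le_iff₀ hq, mul_one]

open scoped Pointwise in
theorem cubeIntegral_of_homogeneous {m : ℕ} {f : (Fin m → ℝ) → ℝ}
    (hf : ∀ r : ℝ, 0 < r → ∀ w, f (r • w) = f w) {q : ℝ} (hq : 0 < q) :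
    cubeIntegral f q = q ^ m * cubeIntegral f 1 := by
  have h := Measure.setIntegral_comp_smul_of_pos volume f (Icc (0 : Fin m → ℝ) (fun _ => 1)) hq
  simp only [hf q hq] at h
  rw [smul_cube hq, Module.finrank_fin_fun, smul_eq_mul] at h
  have : q ^ m ≠ 0 := by positivity
  unfold cubeIntegral
  rw [h, mul_inv_cancel_left₀ this]

theorem cube_subset {m : ℕ} {s t : ℝ} (hst : s ≤ t) :
    Icc (0 : Fin m → ℝ) (fun _ => s) ⊆ Icc 0 (fun _ => t) :=
  Icc_subset_Icc_right fun _ => hst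

theorem norm_le_of_mem_cube {m : ℕ} {w : Fin m → ℝ} {q : ℝ} (hq : 0 ≤ q)
    (hw : w ∈ Icc 0 (fun _ => q)) : ‖w‖ ≤ q :=
  (pi_norm_le_iff_of_nonneg hq).2 fun i => by
    rw [Real.norm_of_nonneg (hw.1 i)]; exact hw.2 i

theorem monotoneOn_cubeIntegral {m : ℕ} {f : (Fin m → ℝ) → ℝ} {r : ℝ}
    (hint : IntegrableOn f (Icc 0 (fun _ => r)))
    (hf : ∀ w ∈ Icc (0 : Fin m → ℝ) (fun _ => r), 0 ≤ f w) :
    MonotoneOn (cubeIntegral f) (Icc 0 r) := fun _ _ _ ht hst =>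
  setIntegral_mono_set (hint.mono_set (cube_subset ht.2))
    ((ae_restrict_iff' measurableSet_Icc).2
      (Filter.Eventually.of_forall fun w hw => hf w (cube_subset ht.2 hw)))
    (cube_subset hst).eventuallyLE

theorem antitoneOn_cubeIntegral {m : ℕ} {f : (Fin m → ℝ) → ℝ} {r : ℝ}
    (hint : IntegrableOn f (Icc 0 (fun _ => 1)))
    (hf : ∀ w ∈ Icc (0 : Fin m → ℝ) (fun _ => 1), r ≤ ‖w‖ → f w ≤ 0) :
    AntitoneOn (cubeIntegral f) (Icc r 1) := by
  intro s hs t ht hst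
  have h1 := setIntegral_sdiff measurableSet_Icc (hint.mono_set (cube_subset ht.2)) (cube_subset hst)
  have h2 : ∫ w in Icc (0 : Fin m → ℝ) (fun _ => t) \ Icc 0 (fun _ => s), f w ≤ 0 := by
    refine setIntegral_nonpos (measurableSet_Icc.diff measurableSet_Icc) fun w hw => ?_
    refine hf w (cube_subset ht.2 hw.1) ?_
    by_contra! hlt
    exact hw.2 ⟨hw.1.1, fun i => (le_abs_self _).trans
      (((norm_le_pi_norm w i).trans hlt.le).trans hs.1)⟩
  unfold cubeIntegral
  linarith

/-! ### Decreasing functions on the cube -/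

/-- Let `f` be decreasing. On each ray from the origin compare `f` with its value at distance
`r = (m + 1) / (m + 2)`, which gives a function `f₀` constant on rays. For `f₀` equality holds, by
scaling and the first-order condition `hm`. The difference `f - f₀` is nonnegative up to distance
`r` and nonpositive beyond, so its integral over `[0, q]^m` increases in `q` up to `r` and decreases
from there on. -/
theorem cubeIntegral_comparison {m : ℕ} {f : (Fin m → ℝ) → ℝ} (hfc : Continuous f)
    (hfa : Antitone f) {K : ℝ} (hK : ∀ w, |f w| ≤ K) {c a : ℝ} (ha : a ∈ Ioo (0 : ℝ) 1)
    (hm : ((m : ℝ) + 2) * a ^ (m + 1) + ((m : ℝ) + 1) * c * a ^ m = 1)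
    (hc0 : 0 ≤ c) (hc : c + 1 ≤ ((m : ℝ) + 2) * (1 - a)) :
    cubeIntegral f 1 + c * cubeIntegral f a ≤
      ((m : ℝ) + 2) * ∫ q in a..1, cubeIntegral f q := by
  obtain ⟨ha0, ha1⟩ := ha
  have hm2 : (0 : ℝ) < (m : ℝ) + 2 := by positivity
  set r : ℝ := ((m : ℝ) + 1) / ((m : ℝ) + 2) with hr
  have hr0 : 0 < r := by positivity
  have hr1 : r ≤ 1 := by rw [hr, div_le_one hm2]; linarith
  have hmr : ((m : ℝ) + 2) * r = (m : ℝ) + 1 := by rw [hr]; field_simp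
  have har : a ≤ r := by rw [hr, le_div_iff₀ hm2]; linarith
  -- At the origin `r / ‖w‖` is `r / 0 = 0`, so that `f₀ 0 = f 0`.
  let f₀ : (Fin m → ℝ) → ℝ := fun w => f ((r / ‖w‖) • w)
  have hf₀m : Measurable f₀ :=
    hfc.measurable.comp ((measurable_const.div measurable_norm).smul measurable_id)
  have hf₀h : ∀ t : ℝ, 0 < t → ∀ w, f₀ (t • w) = f₀ w := by
    intro t ht w
    simp only [f₀, norm_smul, smul_smul, Real.norm_of_nonneg ht.le]
    congr 2
    field_simp
  have hvol : ∀ q : ℝ, volume (Icc (0 : Fin m → ℝ) (fun _ => q)) ≠ ⊤ :=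
    fun q => isCompact_Icc.measure_lt_top.ne
  have hif : ∀ q : ℝ, IntegrableOn f (Icc 0 (fun _ => q)) := fun q =>
    hfc.continuousOn.integrableOn_compact isCompact_Icc
  have hif₀ : ∀ q : ℝ, IntegrableOn f₀ (Icc 0 (fun _ => q)) := fun q =>
    IntegrableOn.of_bound (hvol q).lt_top hf₀m.aestronglyMeasurable K
      (Filter.Eventually.of_forall fun w => hK _)
  let φ : (Fin m → ℝ) → ℝ := f - f₀
  have hiφ : ∀ q : ℝ, IntegrableOn φ (Icc 0 (fun _ => q)) := fun q => (hif q).sub (hif₀ q)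
  have hφ1 : ∀ w ∈ Icc (0 : Fin m → ℝ) (fun _ => r), 0 ≤ φ w := by
    intro w hw
    refine sub_nonneg.2 (hfa fun i => ?_)
    rcases eq_or_ne w 0 with rfl | hw0
    · simp
    have : 1 ≤ r / ‖w‖ := by
      rw [one_le_div (norm_pos_iff.2 hw0)]; exact norm_le_of_mem_cube hr0.le hw
    exact le_mul_of_one_le_left (hw.1 i) this
  have hφ2 : ∀ w ∈ Icc (0 : Fin m → ℝ) (fun _ => 1), r ≤ ‖w‖ → φ w ≤ 0 := by
    intro w hw hrw
    refine sub_nonpos.2 (hfa fun i => ?_)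
    exact mul_le_of_le_one_left (hw.1 i) ((div_le_one (hr0.trans_le hrw)).2 hrw)
  have hmono := monotoneOn_cubeIntegral (hiφ r) hφ1
  have hanti := antitoneOn_cubeIntegral (hiφ 1) hφ2
  have hI1 : IntervalIntegrable (cubeIntegral φ) volume a r :=
    MonotoneOn.intervalIntegrable (by
      rw [uIcc_of_le har]; exact hmono.mono (Icc_subset_Icc_left ha0.le))
  have hI2 : IntervalIntegrable (cubeIntegral φ) volume r 1 :=
    AntitoneOn.intervalIntegrable (by rw [uIcc_of_le hr1]; exact hanti)
  -- The integral over `[0, q]^m` is at least its value at `q = a` for `q ∈ [a, r]`, and at least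
  -- its value at `q = 1` for `q ∈ [r, 1]`.
  have h1 : (r - a) * cubeIntegral φ a ≤ ∫ q in a..r, cubeIntegral φ q := by
    rw [← smul_eq_mul, ← intervalIntegral.integral_const]
    exact intervalIntegral.integral_mono_on har intervalIntegrable_const hI1 fun q hq =>
      hmono ⟨ha0.le, har⟩ ⟨ha0.le.trans hq.1, hq.2⟩ hq.1
  have h2 : (1 - r) * cubeIntegral φ 1 ≤ ∫ q in r..1, cubeIntegral φ q := by
    rw [← smul_eq_mul, ← intervalIntegral.integral_const]
    exact intervalIntegral.integral_mono_on hr1 intervalIntegrable_const hI2 fun q hq =>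
      hanti hq ⟨hr1, le_rfl⟩ hq.2
  have h3 := intervalIntegral.integral_add_adjacent_intervals hI1 hI2
  have h4 : 0 ≤ cubeIntegral φ a :=
    setIntegral_nonneg measurableSet_Icc fun w hw => hφ1 w (cube_subset har hw)
  have hadd : ∀ q, cubeIntegral f q = cubeIntegral φ q + cubeIntegral f₀ q := fun q => by
    rw [← cubeIntegral_add (hiφ q) (hif₀ q)]; simp [φ]
  have hpow : ∀ q : ℝ, 0 < q → cubeIntegral f q = cubeIntegral φ q + q ^ m * cubeIntegral f₀ 1 :=
    fun q hq => by rw [hadd, cubeIntegral_of_homogeneous hf₀h hq]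
  have h5 : ∫ q in a..1, cubeIntegral f q =
      (∫ q in a..1, cubeIntegral φ q) + (1 - a ^ (m + 1)) / ((m : ℝ) + 1) * cubeIntegral f₀ 1 := by
    rw [intervalIntegral.integral_congr (g := fun q => cubeIntegral φ q + q ^ m * cubeIntegral f₀ 1)
      (fun q hq => hpow q (by rw [uIcc_of_le ha1.le] at hq; exact ha0.trans_le hq.1)),
      intervalIntegral.integral_add (hI1.trans hI2)
        (Continuous.intervalIntegrable (by fun_prop) _ _),
      intervalIntegral.integral_mul_const, integral_pow, one_pow]
  -- The first-order condition makes both sides equal for functions constant on rays.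
  have h6 : ((m : ℝ) + 2) * ((1 - a ^ (m + 1)) / ((m : ℝ) + 1)) = 1 + c * a ^ m := by
    rw [mul_div_assoc', div_eq_iff (by positivity)]
    linear_combination -hm
  have h7 : c * cubeIntegral φ a ≤ ((m : ℝ) + 2) * (r - a) * cubeIntegral φ a :=
    mul_le_mul_of_nonneg_right (by rw [mul_sub, hmr]; linarith) h4
  have h8 : ((m : ℝ) + 2) * (1 - r) = 1 := by rw [mul_sub, hmr]; ring
  have h9 : (r - a) * cubeIntegral φ a + (1 - r) * cubeIntegral φ 1 ≤
      ∫ q in a..1, cubeIntegral φ q := by linarith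
  have h10 := mul_le_mul_of_nonneg_left h9 hm2.le
  rw [h5, hpow 1 one_pos, hpow a ha0, one_pow]
  linear_combination h10 + h7 - h8 * cubeIntegral φ 1 - h6 * cubeIntegral f₀ 1

/-! ### The distribution of the values and the faces of the cube -/

theorem valueLaw_eq (n : ℕ) (c : ℝ) : valueLaw n c = volume.restrict (typeSpace n c) := by
  simp_rw [valueLaw, uniformLaw_eq, typeSpace, ← Set.pi_univ_Icc, volume_pi,
    Measure.restrict_pi_pi]

instance instNullSingletonClassUniformLaw (c : ℝ) : NullSingletonClass (uniformLaw c) := by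
  rw [uniformLaw_eq]; infer_instance

theorem integral_valueLaw {n : ℕ} (c : ℝ) (F : (Fin n → ℝ) → ℝ) :
    ∫ x, F x ∂valueLaw n c = ∫ w in Icc 0 1, F ((fun _ => c) + w) := by
  rw [valueLaw_eq, typeSpace, ← integral_indicator measurableSet_Icc,
    ← integral_indicator measurableSet_Icc, ← integral_add_left_eq_self _ (fun _ => c)]
  congr 1
  ext w
  have : (fun _ => c) + w ∈ Icc (fun _ : Fin n => c) (fun _ => c + 1) ↔ w ∈ Icc 0 1 := by
    simp [Pi.le_def]
  by_cases hw : w ∈ Icc (0 : Fin n → ℝ) 1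
  · rw [indicator_of_mem hw, indicator_of_mem (this.2 hw)]
  · rw [indicator_of_notMem hw, indicator_of_notMem (mt this.1 hw)]

theorem measurable_insertNth {m : ℕ} (i : Fin (m + 1)) (s : ℝ) :
    Measurable fun w : Fin m → ℝ => (i.insertNth s w : Fin (m + 1) → ℝ) :=
  measurable_pi_iff.2 ((Fin.forall_iff_succAbove i).2
    ⟨by simp, fun j => by simpa using measurable_pi_apply j⟩)

/-- The overwritten coordinate of `faceMeasure` can be left out. -/
theorem faceMeasure_eq_map_insertNth {m : ℕ} (c : ℝ) (i : Fin (m + 1)) (s : ℝ) :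
    faceMeasure (m + 1) c i s = (valueLaw m c).map fun w => i.insertNth s w := by
  have h := measurePreserving_piFinSuccAbove (fun _ : Fin (m + 1) => uniformLaw c) i
  have h2 : (valueLaw (m + 1) c).map (i.removeNth) = valueLaw m c := by
    have : (i.removeNth : (Fin (m + 1) → ℝ) → Fin m → ℝ) =
        Prod.snd ∘ MeasurableEquiv.piFinSuccAbove (fun _ : Fin (m + 1) => ℝ) i := rfl
    rw [this, ← Measure.map_map measurable_snd (MeasurableEquiv.measurable _), valueLaw, h.map_eq,
      Measure.map_snd_prod, measure_univ, one_smul]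
    rfl
  have h3 : (fun x : Fin (m + 1) → ℝ => Function.update x i s) =
      (fun w => i.insertNth s w) ∘ i.removeNth := by
    ext1 x
    exact (Fin.insertNth_removeNth i s x).symm
  have hm : Measurable (i.removeNth : (Fin (m + 1) → ℝ) → Fin m → ℝ) :=
    measurable_pi_iff.2 fun j => measurable_pi_apply _
  rw [faceMeasure, h3, ← Measure.map_map (measurable_insertNth i s) hm, h2]

theorem measurable_update_face {n : ℕ} (i : Fin n) (s : ℝ) :
    Measurable fun x : Fin n → ℝ => Function.update x i s :=
  measurable_pi_iff.2 fun j => by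
    by_cases h : j = i
    · subst h; simp
    · simpa [Function.update_of_ne h] using measurable_pi_apply j

theorem ae_mem_typeSpace (n : ℕ) (c : ℝ) : ∀ᵐ x ∂valueLaw n c, x ∈ typeSpace n c := by
  rw [valueLaw_eq]; exact ae_restrict_mem measurableSet_Icc

theorem ae_faceMeasure {n : ℕ} {c s : ℝ} (hs : s ∈ Icc c (c + 1)) (i : Fin n) :
    ∀ᵐ x ∂faceMeasure n c i s, x ∈ typeSpace n c ∧ x i = s := by
  have hS : MeasurableSet {x : Fin n → ℝ | x ∈ typeSpace n c ∧ x i = s} :=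
    measurableSet_Icc.inter (measurableSet_eq_fun (measurable_pi_apply i) measurable_const)
  rw [faceMeasure, ae_map_iff (measurable_update_face i s).aemeasurable hS]
  filter_upwards [ae_mem_typeSpace n c] with x hx
  refine ⟨⟨fun j => ?_, fun j => ?_⟩, by simp⟩ <;> by_cases h : j = i
  · subst h; simpa using hs.1
  · simpa [Function.update_of_ne h] using hx.1 j
  · subst h; simpa using hs.2
  · simpa [Function.update_of_ne h] using hx.2 j

theorem valueLaw_hyperplane (n : ℕ) (c : ℝ) (i : Fin n) (s : ℝ) :
    valueLaw n c {x | x i = s} = 0 :=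
  Measure.pi_hyperplane (fun _ : Fin n => uniformLaw c) i s

theorem faceMeasure_hyperplane {n : ℕ} (c : ℝ) {i j : Fin n} (h : j ≠ i) (s t : ℝ) :
    faceMeasure n c i s {x | x j = t} = 0 := by
  rw [faceMeasure, Measure.map_apply (measurable_update_face i s)
    (measurableSet_eq_fun (measurable_pi_apply j) measurable_const)]
  convert valueLaw_hyperplane n c j t using 2
  ext x
  simp [Function.update_of_ne h]

/-! ### The Jordan decomposition of the transformed measure -/

/-- The positive summands of the transformed measure. -/
noncomputable def positiveMass (n : ℕ) (c : ℝ) : Measure (Fin n → ℝ) :=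
  Measure.dirac (fun _ => c) + ∑ i : Fin n, (c + 1).toNNReal • faceMeasure n c i (c + 1)

/-- The negative summands of the transformed measure, with the sign reversed. -/
noncomputable def negativeMass (n : ℕ) (c : ℝ) : Measure (Fin n → ℝ) :=
  ((n : NNReal) + 1) • valueLaw n c + ∑ i : Fin n, c.toNNReal • faceMeasure n c i c

instance instIsFiniteMeasurePositiveMass (n : ℕ) (c : ℝ) : IsFiniteMeasure (positiveMass n c) := by
  unfold positiveMass; infer_instance

instance instIsFiniteMeasureNegativeMass (n : ℕ) (c : ℝ) : IsFiniteMeasure (negativeMass n c) := by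
  unfold negativeMass; infer_instance

theorem transformedMeasure_eq (n : ℕ) {c : ℝ} (hc : 0 ≤ c) :
    transformedMeasure n c =
      (positiveMass n c).toSignedMeasure - (negativeMass n c).toSignedMeasure := by
  have hsum : ∀ (r : NNReal) (s : ℝ) (A : Set (Fin n → ℝ)),
      (∑ i : Fin n, r • faceMeasure n c i s).real A =
        ∑ i : Fin n, (r : ℝ) * (faceMeasure n c i s).real A := by
    intro r s A
    simp only [Measure.real, Measure.finsetSum_apply, Measure.smul_apply]
    rw [ENNReal.toReal_sum fun i _ => by
      rw [ENNReal.smul_def]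
      exact ENNReal.mul_ne_top ENNReal.coe_ne_top (measure_ne_top _ _)]
    simp [ENNReal.smul_def]
  ext A hA
  have hP : (positiveMass n c).real A = (Measure.dirac (fun _ : Fin n => c)).real A +
      ∑ i : Fin n, (c + 1) * (faceMeasure n c i (c + 1)).real A := by
    rw [positiveMass, measureReal_add_apply (measure_ne_top _ _) (measure_ne_top _ _), hsum,
      Real.coe_toNNReal _ (by linarith)]
  have hN : (negativeMass n c).real A = ((n : ℝ) + 1) * (valueLaw n c).real A +
      ∑ i : Fin n, c * (faceMeasure n c i c).real A := by
    rw [negativeMass, measureReal_add_apply (measure_ne_top _ _) (measure_ne_top _ _), hsum,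
      Real.coe_toNNReal _ hc, measureReal_nnreal_smul_apply]
    simp
  simp only [transformedMeasure, sub_apply, add_apply, FunLike.coe_sum, Finset.sum_apply,
    smul_apply, Measure.toSignedMeasure_apply_measurable hA, hP, hN, smul_eq_mul,
    Finset.sum_sub_distrib]
  ring

theorem mutuallySingular_positiveMass_negativeMass {n : ℕ} (hn : 2 ≤ n) (c : ℝ) :
    (positiveMass n c).MutuallySingular (negativeMass n c) := by
  have : Nontrivial (Fin n) := Fin.nontrivial_iff_two_le.2 hn
  let H : Fin n → Set (Fin n → ℝ) := fun i => {x | x i = c + 1}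
  have hH : ∀ i, MeasurableSet (H i) := fun i =>
    measurableSet_eq_fun (measurable_pi_apply i) measurable_const
  have hS : MeasurableSet ({fun _ => c} ∪ ⋃ i, H i) :=
    (measurableSet_singleton _).union (MeasurableSet.iUnion hH)
  -- The positive summands live on the corner and the top faces, which are null for the negative
  -- ones.
  refine ⟨({fun _ => c} ∪ ⋃ i, H i)ᶜ, hS.compl, ?_, ?_⟩
  · have h : ∀ i, faceMeasure n c i (c + 1) ({fun _ => c} ∪ ⋃ i, H i)ᶜ = 0 := by
      intro i
      refine measure_mono_null (fun x hx => ?_)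
        (ae_faceMeasure (s := c + 1) ⟨by linarith, le_rfl⟩ i)
      exact fun h => hx (Or.inr (mem_iUnion.2 ⟨i, h.2⟩))
    simp [positiveMass, h, Measure.dirac_apply' _ hS.compl, -compl_union, -singleton_union]
  · rw [compl_compl]
    have h1 : valueLaw n c ({fun _ => c} ∪ ⋃ i, H i) = 0 := by
      refine measure_union_null ?_ (measure_iUnion_null fun i => valueLaw_hyperplane n c i _)
      exact measure_mono_null (fun x hx => by rw [mem_singleton_iff.1 hx]; rfl)
        (valueLaw_hyperplane n c ⟨0, by omega⟩ c)
    have h2 : ∀ i, faceMeasure n c i c ({fun _ => c} ∪ ⋃ i, H i) = 0 := by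
      intro i
      refine measure_union_null ?_ (measure_iUnion_null fun j => ?_)
      · obtain ⟨j, hj⟩ := exists_ne i
        exact measure_mono_null (fun x hx => by rw [mem_singleton_iff.1 hx]; rfl)
          (faceMeasure_hyperplane c hj c c)
      · by_cases hj : j = i
        · subst hj
          refine measure_mono_null (fun x (hx : x j = c + 1) => ?_)
            (ae_faceMeasure (s := c) ⟨le_rfl, by linarith⟩ j)
          exact fun h => by linarith [h.2]
        · exact faceMeasure_hyperplane c hj c _
    simp [negativeMass, h1, h2, -singleton_union]

theorem jordan_transformedMeasure {n : ℕ} (hn : 2 ≤ n) {c : ℝ} (hc : 0 ≤ c) :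
    (transformedMeasure n c).toJordanDecomposition =
      ⟨positiveMass n c, negativeMass n c, mutuallySingular_positiveMass_negativeMass hn c⟩ :=
  SignedMeasure.toJordanDecomposition_eq (transformedMeasure_eq n hc)

theorem muPlus_eq {n : ℕ} (hn : 2 ≤ n) {c : ℝ} (hc : 0 ≤ c) : muPlus n c = positiveMass n c := by
  rw [muPlus, jordan_transformedMeasure hn hc]

theorem muMinus_eq {n : ℕ} (hn : 2 ≤ n) {c : ℝ} (hc : 0 ≤ c) : muMinus n c = negativeMass n c := by
  rw [muMinus, jordan_transformedMeasure hn hc]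

instance instIsFiniteMeasureMuMinus (n : ℕ) (c : ℝ) : IsFiniteMeasure (muMinus n c) :=
  (transformedMeasure n c).toJordanDecomposition.negPart_finite

/-! ### The pushed measure -/

theorem le_maxCoord {n : ℕ} (x : Fin n → ℝ) (i : Fin n) : x i ≤ maxCoord x :=
  le_ciSup (finite_range x).bddAbove i

theorem maxCoord_le {m : ℕ} {x : Fin (m + 1) → ℝ} {r : ℝ} (h : ∀ i, x i ≤ r) : maxCoord x ≤ r :=
  ciSup_le h

theorem maxCoord_eq_of_isGreatest {n : ℕ} {x : Fin n → ℝ} {i : Fin n} (h : ∀ j, x j ≤ x i) :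
    maxCoord x = x i :=
  have : Nonempty (Fin n) := ⟨i⟩
  le_antisymm (ciSup_le h) (le_maxCoord x i)

theorem exists_maxCoord_eq {m : ℕ} (x : Fin (m + 1) → ℝ) : ∃ i, maxCoord x = x i := by
  obtain ⟨i, hi⟩ := Finite.exists_max x
  exact ⟨i, maxCoord_eq_of_isGreatest hi⟩

theorem continuous_maxCoord (m : ℕ) : Continuous (maxCoord : (Fin (m + 1) → ℝ) → ℝ) := by
  have : (maxCoord : (Fin (m + 1) → ℝ) → ℝ) =
      fun x => Finset.univ.sup' Finset.univ_nonempty fun i => x i := by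
    ext x
    rw [Finset.sup'_univ_eq_ciSup]
    rfl
  rw [this]
  exact Continuous.finset_sup'_apply _ fun i _ => continuous_apply i

/-- The translation of `x` along the diagonal to the set of points with largest
coordinate `c + 1`. -/
noncomputable def diagonalShift {n : ℕ} (c : ℝ) (x : Fin n → ℝ) : Fin n → ℝ :=
  fun i => x i + (c + 1 - maxCoord x)

theorem continuous_diagonalShift (m : ℕ) (c : ℝ) :
    Continuous (diagonalShift c : (Fin (m + 1) → ℝ) → Fin (m + 1) → ℝ) :=
  continuous_pi fun i =>
    (continuous_apply i).add (continuous_const.sub (continuous_maxCoord m))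

theorem diagonalShift_mem_regionB {m : ℕ} {c : ℝ} {y : Fin (m + 1) → ℝ}
    (hy : y ∈ typeSpace (m + 1) c) : diagonalShift c y ∈ regionB (m + 1) c := by
  have hle : maxCoord y ≤ c + 1 := maxCoord_le hy.2
  refine ⟨⟨fun i => ?_, fun i => ?_⟩, ?_⟩
  · have := hy.1 i
    simp only [diagonalShift] at this ⊢; linarith
  · have := le_maxCoord y i
    simp only [diagonalShift]; linarith
  · obtain ⟨i, hi⟩ := exists_maxCoord_eq y
    rw [maxCoord_eq_of_isGreatest (i := i) fun j => by
      have := le_maxCoord y j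
      simp only [diagonalShift]; linarith]
    simp only [diagonalShift]; linarith

theorem measurableSet_regionB (m : ℕ) (c : ℝ) : MeasurableSet (regionB (m + 1) c) :=
  measurableSet_Icc.inter ((continuous_maxCoord m).measurable (measurableSet_singleton _))

/-- The part `W ∪ B_Z` of the type space: the types that buy at the price `p`, or are indifferent. -/
def buyers (n : ℕ) (c p : ℝ) : Set (Fin n → ℝ) :=
  typeSpace n c ∩ {y | p ≤ maxCoord y}

theorem isCompact_buyers (m : ℕ) (c p : ℝ) : IsCompact (buyers (m + 1) c p) :=
  isCompact_Icc.inter_right (isClosed_le continuous_const (continuous_maxCoord m))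

/-- Among the `x ∈ B` with `u*(x) - u*(y) = ‖x - y‖`, the diagonal shift of `y` is the largest. So
`y` is pushed to an upper set exactly if its diagonal shift lies in that set. -/
theorem push_eq {m : ℕ} {c p : ℝ} (hp : p ≤ c + 1) {U : Set (Fin (m + 1) → ℝ)}
    (hU : IsUpperIn (regionB (m + 1) c) U) :
    push (m + 1) c p U = buyers (m + 1) c p ∩ diagonalShift c ⁻¹' U := by
  have hutil : ∀ x : Fin (m + 1) → ℝ, p ≤ maxCoord x →
      uniformPricingUtility p x = maxCoord x - p := fun x hx => max_eq_left (by linarith)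
  have hdiff : ∀ x ∈ regionB (m + 1) c, ∀ y : Fin (m + 1) → ℝ, p ≤ maxCoord y →
      uniformPricingUtility p x - uniformPricingUtility p y = c + 1 - maxCoord y := by
    intro x hx y hy
    rw [hutil x (hp.trans_eq hx.2.symm), hutil y hy, hx.2]
    ring
  ext y
  constructor
  · rintro ⟨hy, x, ⟨hxU, hxB⟩, heq⟩
    have hyb : y ∈ buyers (m + 1) c p := by
      rcases hy with hy | hy
      · exact ⟨hy.1, hy.2.1.le⟩
      · exact ⟨hy.1, hy.2.ge⟩
    refine ⟨hyb, hU.2 x hxU _ (diagonalShift_mem_regionB hyb.1) fun i => ?_⟩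
    rw [hdiff x hxB y hyb.2] at heq
    have := (le_abs_self _).trans (norm_le_pi_norm (x - y) i)
    rw [← heq, Pi.sub_apply] at this
    simp only [diagonalShift]
    linarith
  · rintro ⟨hyb, hyU⟩
    have hle : maxCoord y ≤ c + 1 := maxCoord_le hyb.1.2
    refine ⟨?_, diagonalShift c y, ⟨hyU, hU.1 hyU⟩, ?_⟩
    · rcases eq_or_lt_of_le (show p ≤ maxCoord y from hyb.2) with h | h
      · exact Or.inr ⟨hyb.1, h.symm⟩
      · exact Or.inl ⟨hyb.1, h, hle⟩
    · have : diagonalShift c y - y = fun _ => c + 1 - maxCoord y := by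
        ext i; simp [diagonalShift]
      rw [hdiff _ (hU.1 hyU) y hyb.2, this, pi_norm_const, Real.norm_of_nonneg (by linarith)]

/-- The image of `μ₋`, restricted to the buyers, under the diagonal shift. -/
noncomputable def pushedMeasure (n : ℕ) (c p : ℝ) : Measure (Fin n → ℝ) :=
  ((muMinus n c).restrict (buyers n c p)).map (diagonalShift c)

theorem isPushedMeasure_pushedMeasure {m : ℕ} {c p : ℝ} (hp : p ≤ c + 1) :
    IsPushedMeasure (m + 1) c p (pushedMeasure (m + 1) c p) := by
  have hS := (isCompact_buyers m c p).measurableSet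
  have hT := (continuous_diagonalShift m c).measurable
  refine ⟨?_, fun U hU hUB => ?_⟩
  · rw [pushedMeasure, Measure.map_apply hT (measurableSet_regionB m c).compl,
      Measure.restrict_apply (hT (measurableSet_regionB m c).compl)]
    convert measure_empty (μ := muMinus (m + 1) c)
    rw [← disjoint_iff_inter_eq_empty, disjoint_left]
    exact fun y hy hyb => hy (diagonalShift_mem_regionB hyb.1)
  · rw [pushedMeasure, Measure.map_apply hT hU, Measure.restrict_apply (hT hU), push_eq hp hUB,
      inter_comm]

theorem borel_eq_generateFrom_isUpperSet (n : ℕ) :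
    (MeasurableSpace.pi : MeasurableSpace (Fin n → ℝ)) =
      MeasurableSpace.generateFrom {S | MeasurableSet S ∧ IsUpperSet S} := by
  refine le_antisymm ?_ (MeasurableSpace.generateFrom_le fun S hS => hS.1)
  refine iSup_le fun i => ?_
  rw [← measurable_iff_comap_le]
  refine @measurable_of_Ici ℝ (Fin n → ℝ) _ _ _ (_) inferInstance inferInstance inferInstance _ fun a => ?_
  refine MeasurableSpace.measurableSet_generateFrom ⟨measurable_pi_apply i measurableSet_Ici, ?_⟩
  exact fun x y hxy hx => le_trans (mem_Ici.1 hx) (hxy i)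

theorem IsPushedMeasure.unique {m : ℕ} {c p : ℝ} {μ ν : Measure (Fin (m + 1) → ℝ)}
    (hμ : IsPushedMeasure (m + 1) c p μ) (hν : IsPushedMeasure (m + 1) c p ν) : μ = ν := by
  have hB := measurableSet_regionB m c
  have key : ∀ S : Set (Fin (m + 1) → ℝ), MeasurableSet S → IsUpperSet S → ∀ μ,
      IsPushedMeasure (m + 1) c p μ →
        μ S = muMinus (m + 1) c (push (m + 1) c p (S ∩ regionB (m + 1) c)) := by
    intro S hS hSu μ hμ
    rw [← hμ.2 _ (hS.inter hB) ⟨inter_subset_right, fun x hx x' hx' hle =>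
      ⟨hSu hle hx.1, hx'⟩⟩]
    have h0 : μ (S \ regionB (m + 1) c) = 0 := measure_mono_null (fun x hx => hx.2) hμ.1
    rw [← measure_inter_add_sdiff S hB, h0, add_zero]
  have : IsFiniteMeasure μ := ⟨by
    rw [key univ MeasurableSet.univ isUpperSet_univ μ hμ]; exact measure_lt_top _ _⟩
  refine ext_of_generate_finite _ (borel_eq_generateFrom_isUpperSet (m + 1)) ?_ ?_ ?_
  · rintro S ⟨hS, hSu⟩ S' ⟨hS', hSu'⟩ -
    exact ⟨hS.inter hS', hSu.inter hSu'⟩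
  · rintro S ⟨hS, hSu⟩
    rw [key S hS hSu μ hμ, key S hS hSu ν hν]
  · rw [key univ MeasurableSet.univ isUpperSet_univ μ hμ,
      key univ MeasurableSet.univ isUpperSet_univ ν hν]

theorem isPushedMeasure_iff {m : ℕ} {c p : ℝ} (hp : p ≤ c + 1) (ν : Measure (Fin (m + 1) → ℝ)) :
    IsPushedMeasure (m + 1) c p ν ↔ ν = pushedMeasure (m + 1) c p :=
  ⟨fun h => h.unique (isPushedMeasure_pushedMeasure hp),
    fun h => h ▸ isPushedMeasure_pushedMeasure hp⟩

/-! ### Integrals against the two measures on the top faces -/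

theorem integrableOn_indicator_cube {n : ℕ} {v : (Fin n → ℝ) → ℝ} (hv : Continuous v)
    {S : Set (Fin n → ℝ)} (hS : MeasurableSet S) : IntegrableOn (S.indicator v) (Icc 0 1) :=
  Integrable.indicator (hv.continuousOn.integrableOn_compact isCompact_Icc) hS

/-- Cutting a cone of the unit cube off at height `a`; the value at the height `a` itself does not
matter. -/
theorem setIntegral_cone_of_threshold {m : ℕ} {a : ℝ} (ha : 0 ≤ a) (ha1 : a ≤ 1)
    {G : ℝ → (Fin m → ℝ) → ℝ} {h : ℝ → (Fin m → ℝ) → ℝ}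
    (h1 : ∀ q ∈ Ioc a 1, ∀ w ∈ Icc (0 : Fin m → ℝ) (fun _ => q), G q w = h q w)
    (h0 : ∀ q ∈ Ico 0 a, ∀ w ∈ Icc (0 : Fin m → ℝ) (fun _ => q), G q w = 0) :
    ∫ q in Icc (0 : ℝ) 1, ∫ w in Icc (0 : Fin m → ℝ) (fun _ => q), G q w =
      ∫ q in a..1, cubeIntegral (h q) q := by
  have hne : ∀ᵐ q : ℝ, q ≠ a := Measure.ae_ne volume a
  rw [intervalIntegral.integral_of_le ha1, setIntegral_eq_of_subset_of_ae_sdiff_eq_zero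
    (s := Ioc a 1) measurableSet_Icc.nullMeasurableSet
    (Ioc_subset_Icc_self.trans (Icc_subset_Icc_left ha))]
  · exact setIntegral_congr_fun measurableSet_Ioc fun q hq =>
      setIntegral_congr_fun measurableSet_Icc (h1 q hq)
  · filter_upwards [hne] with q hqa hq
    have hlt : q < a := lt_of_le_of_ne (not_lt.1 fun h => hq.2 ⟨h, hq.1.2⟩) hqa
    rw [setIntegral_congr_fun measurableSet_Icc (h0 q ⟨hq.1.1, hlt⟩)]
    simp

/-- The restriction of `u` to the top face `x i = c + 1`, in the coordinates `w = c + 1 - x`. -/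
noncomputable def topFace {m : ℕ} (u : (Fin (m + 1) → ℝ) → ℝ) (c : ℝ) (i : Fin (m + 1)) :
    (Fin m → ℝ) → ℝ :=
  fun w => u ((fun _ => c + 1) - i.insertNth 0 w)

theorem continuous_insertNth {m : ℕ} (i : Fin (m + 1)) (s : ℝ) :
    Continuous fun w : Fin m → ℝ => (i.insertNth s w : Fin (m + 1) → ℝ) :=
  continuous_const.finInsertNth i continuous_id

theorem continuous_topFace {m : ℕ} {u : (Fin (m + 1) → ℝ) → ℝ} (hu : Continuous u) (c : ℝ)
    (i : Fin (m + 1)) : Continuous (topFace u c i) :=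
  hu.comp (continuous_const.sub (continuous_insertNth i 0))

theorem maxCoord_add_insertNth {m : ℕ} (c : ℝ) {q : ℝ} (k : Fin (m + 1)) {w : Fin m → ℝ}
    (hw : w ∈ Icc 0 (fun _ => q)) :
    maxCoord ((fun _ => c) + k.insertNth q w) = c + q := by
  rw [maxCoord_eq_of_isGreatest (i := k)]
  · simp
  · refine (Fin.forall_iff_succAbove k).2 ⟨le_rfl, fun j => ?_⟩
    simpa using hw.2 j

theorem diagonalShift_add_insertNth {m : ℕ} (c : ℝ) {q : ℝ} (k : Fin (m + 1)) {w : Fin m → ℝ}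
    (hw : w ∈ Icc 0 (fun _ => q)) :
    diagonalShift c ((fun _ => c) + k.insertNth q w) =
      (fun _ => c + 1) - k.insertNth 0 ((fun _ => q) - w) := by
  ext i
  simp only [diagonalShift, maxCoord_add_insertNth c k hw, Pi.add_apply, Pi.sub_apply]
  refine (Fin.forall_iff_succAbove (P := fun i => c + k.insertNth (α := fun _ => ℝ) q w i
    + (c + 1 - (c + q)) = c + 1 - k.insertNth (α := fun _ => ℝ) 0 ((fun _ => q) - w) i) k).2
    ⟨?_, fun j => ?_⟩ i
  · simp
  · simp; ring

theorem add_insertNth_mem_typeSpace {m : ℕ} (c : ℝ) {q : ℝ} (hq : q ∈ Icc (0 : ℝ) 1)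
    (k : Fin (m + 1)) {w : Fin m → ℝ} (hw : w ∈ Icc 0 (fun _ => q)) :
    (fun _ => c) + k.insertNth q w ∈ typeSpace (m + 1) c := by
  constructor
  · refine (Fin.forall_iff_succAbove k).2 ⟨?_, fun j => ?_⟩
    · simpa using hq.1
    · simpa using hw.1 j
  · refine (Fin.forall_iff_succAbove k).2 ⟨?_, fun j => ?_⟩
    · simpa using hq.2
    · simpa using (hw.2 j).trans hq.2

/-- The uniform mass of the cube, restricted to the buyers and pushed to the top faces. -/
theorem setIntegral_buyers_valueLaw {m : ℕ} {u : (Fin (m + 1) → ℝ) → ℝ} (hu : Continuous u)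
    (c : ℝ) {a : ℝ} (ha : a ∈ Ioo (0 : ℝ) 1) :
    ∫ y in buyers (m + 1) c (c + a), u (diagonalShift c y) ∂valueLaw (m + 1) c =
      ∑ k, ∫ q in a..1, cubeIntegral (topFace u c k) q := by
  have hS := (isCompact_buyers m c (c + a)).measurableSet
  rw [← integral_indicator hS, integral_valueLaw, setIntegral_cube_eq_sum_cone]
  · refine Finset.sum_congr rfl fun k _ => ?_
    rw [setIntegral_cone_of_threshold ha.1.le ha.2.le
      (h := fun q w => topFace u c k ((fun _ => q) - w))]
    · simp only [cubeIntegral_reflect]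
    · intro q hq w hw
      rw [indicator_of_mem]
      · rw [diagonalShift_add_insertNth c k hw]; rfl
      · refine ⟨add_insertNth_mem_typeSpace c ⟨ha.1.le.trans hq.1.le, hq.2⟩ k hw, ?_⟩
        rw [mem_ofPred_eq, maxCoord_add_insertNth c k hw]
        linarith [hq.1]
    · intro q hq w hw
      refine indicator_of_notMem (fun h => ?_) _
      have h2 : c + a ≤ _ := h.2
      rw [maxCoord_add_insertNth c k hw] at h2
      linarith [hq.2]
  · exact integrableOn_indicator_cube
      (v := fun w => u (diagonalShift c ((fun _ => c) + w)))
      (hu.comp ((continuous_diagonalShift m c).comp (continuous_const.add continuous_id)))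
      (S := (fun w => (fun _ => c) + w) ⁻¹' buyers (m + 1) c (c + a))
      ((measurable_const.add measurable_id) hS)

/-- The point of the bottom face `x j = c` whose other coordinates have their largest value `c + q`
at position `k`, seen from its largest coordinate `j.succAbove k`. -/
theorem insertNth_add_insertNth {m : ℕ} (c q : ℝ) (j : Fin (m + 2)) (k : Fin (m + 1))
    (w : Fin m → ℝ) :
    (j.insertNth c ((fun _ => c) + k.insertNth q w : Fin (m + 1) → ℝ) : Fin (m + 2) → ℝ) =
      (fun _ => c) + (j.succAbove k).insertNth q ((k.predAbove j).insertNth 0 w) := by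
  have h1 : (j.succAbove k).succAbove (k.predAbove j) = j := Fin.succAbove_succAbove_predAbove j k
  rw [Fin.insertNth_eq_iff]
  constructor
  · have h2 := Fin.insertNth_apply_succAbove (α := fun _ => ℝ) (j.succAbove k) q
      ((k.predAbove j).insertNth 0 w) (k.predAbove j)
    rw [h1, Fin.insertNth_apply_same] at h2
    rw [Pi.add_apply, h2, add_zero]
  · ext i
    simp only [Fin.removeNth, Pi.add_apply, add_right_inj]
    revert i
    refine (Fin.forall_iff_succAbove k).2 ⟨by simp, fun i => ?_⟩
    rw [← Fin.succAbove_succAbove_succAbove_predAbove j k i]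
    simp

/-- The sum over ordered pairs of distinct coordinates `j` and `j.succAbove k`, in either order. -/
theorem sum_succAbove_predAbove {m : ℕ} (g : Fin (m + 2) → Fin (m + 1) → ℝ) :
    ∑ j : Fin (m + 2), ∑ k : Fin (m + 1), g (j.succAbove k) (k.predAbove j) = ∑ i, ∑ l, g i l := by
  rw [← Fintype.sum_prod_type', ← Fintype.sum_prod_type']
  let σ : Fin (m + 2) × Fin (m + 1) → Fin (m + 2) × Fin (m + 1) :=
    fun x => (x.1.succAbove x.2, x.2.predAbove x.1)
  have hσ : Function.Involutive σ := fun x => Prod.ext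
    (Fin.succAbove_succAbove_predAbove x.1 x.2) (Fin.predAbove_predAbove_succAbove x.1 x.2)
  exact Equiv.sum_comp hσ.toPerm fun x => g x.1 x.2

/-- The integral over `[0, 1] ^ (m + 1)` outside `[0, a] ^ (m + 1)`, by the position and the value
`q` of the largest coordinate. -/
theorem cubeIntegral_one_sub_cubeIntegral {m : ℕ} {f : (Fin (m + 1) → ℝ) → ℝ} (hf : Continuous f)
    {a : ℝ} (ha : a ∈ Ioo (0 : ℝ) 1) :
    cubeIntegral f 1 - cubeIntegral f a =
      ∑ l : Fin (m + 1), ∫ q in a..1, cubeIntegral (fun w => f (l.insertNth q w)) q := by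
  have hS : MeasurableSet (Icc (0 : Fin (m + 1) → ℝ) (fun _ => a))ᶜ := measurableSet_Icc.compl
  have h1 : cubeIntegral f 1 - cubeIntegral f a =
      ∫ w in Icc 0 1, (Icc (0 : Fin (m + 1) → ℝ) (fun _ => a))ᶜ.indicator f w := by
    rw [setIntegral_indicator hS, ← sdiff_eq_compl_inter.trans (inter_comm _ _),
      setIntegral_sdiff measurableSet_Icc (hf.continuousOn.integrableOn_compact isCompact_Icc)
        (show Icc 0 (fun _ => a) ⊆ Icc 0 1 from cube_subset ha.2.le)]
    rfl
  rw [h1, setIntegral_cube_eq_sum_cone (integrableOn_indicator_cube hf hS)]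
  refine Finset.sum_congr rfl fun l _ => ?_
  refine setIntegral_cone_of_threshold ha.1.le ha.2.le (fun q hq w hw => ?_) fun q hq w hw => ?_
  · refine indicator_of_mem (fun h => ?_) _
    have := h.2 l
    rw [Fin.insertNth_apply_same] at this
    linarith [hq.1]
  · refine indicator_of_notMem (not_not.2 ⟨?_, ?_⟩) _
    · refine (Fin.forall_iff_succAbove l).2 ⟨by simpa using hq.1, fun j => by simpa using hw.1 j⟩
    · refine (Fin.forall_iff_succAbove l).2 ⟨by simpa using hq.2.le, fun j => ?_⟩
      simpa using (hw.2 j).trans hq.2.le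

theorem integral_faceMeasure {m : ℕ} {v : (Fin (m + 1) → ℝ) → ℝ} (hv : Measurable v) (c : ℝ)
    (i : Fin (m + 1)) (s : ℝ) :
    ∫ x, v x ∂faceMeasure (m + 1) c i s =
      ∫ w in Icc 0 1, v (i.insertNth s ((fun _ => c) + w)) := by
  rw [faceMeasure_eq_map_insertNth, integral_map (measurable_insertNth i s).aemeasurable
    hv.aestronglyMeasurable, integral_valueLaw]

/-- The uniform mass of the bottom faces, restricted to the buyers and pushed to the top faces.
The point of the face `x j = c` whose largest coordinate is the `i`-th one goes to the face
`x i = c + 1`, where its `j`-th coordinate is the smallest. -/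
theorem sum_setIntegral_buyers_faceMeasure {m : ℕ} {u : (Fin (m + 2) → ℝ) → ℝ} (hu : Continuous u)
    (c : ℝ) {a : ℝ} (ha : a ∈ Ioo (0 : ℝ) 1) :
    ∑ j, ∫ y in buyers (m + 2) c (c + a), u (diagonalShift c y) ∂faceMeasure (m + 2) c j c =
      ∑ i, (cubeIntegral (topFace u c i) 1 - cubeIntegral (topFace u c i) a) := by
  have hS := (isCompact_buyers (m + 1) c (c + a)).measurableSet
  have huT : Continuous fun y => u (diagonalShift c y) :=
    hu.comp (continuous_diagonalShift (m + 1) c)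
  have hface : ∀ j, ∫ y in buyers (m + 2) c (c + a), u (diagonalShift c y)
      ∂faceMeasure (m + 2) c j c = ∑ k : Fin (m + 1), ∫ q in a..1, cubeIntegral (fun w =>
        topFace u c (j.succAbove k) ((k.predAbove j).insertNth q w)) q := by
    intro j
    rw [← integral_indicator hS, integral_faceMeasure (huT.measurable.indicator hS),
      setIntegral_cube_eq_sum_cone]
    · refine Finset.sum_congr rfl fun k _ => ?_
      have hmem : ∀ q : ℝ, 0 ≤ q → ∀ w ∈ Icc (0 : Fin m → ℝ) (fun _ => q),
          ((k.predAbove j).insertNth 0 w : Fin (m + 1) → ℝ) ∈ Icc 0 (fun _ => q) := by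
        intro q hq w hw
        constructor
        · exact (Fin.forall_iff_succAbove (k.predAbove j)).2
            ⟨by simp, fun j => by simpa using hw.1 j⟩
        · exact (Fin.forall_iff_succAbove (k.predAbove j)).2
            ⟨by simpa using hq, fun j => by simpa using hw.2 j⟩
      rw [setIntegral_cone_of_threshold ha.1.le ha.2.le (h := fun q w =>
        topFace u c (j.succAbove k) ((k.predAbove j).insertNth q ((fun _ => q) - w)))]
      · refine intervalIntegral.integral_congr fun q _ => ?_
        exact cubeIntegral_reflect
          (fun w => topFace u c (j.succAbove k) ((k.predAbove j).insertNth q w)) q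
      · intro q hq w hw
        have hq0 := ha.1.le.trans hq.1.le
        rw [insertNth_add_insertNth, indicator_of_mem]
        · rw [diagonalShift_add_insertNth c _ (hmem q hq0 w hw), topFace]
          congr 3
          ext i
          revert i
          refine (Fin.forall_iff_succAbove (k.predAbove j)).2 ⟨by simp, fun i => by simp⟩
        · refine ⟨add_insertNth_mem_typeSpace c ⟨hq0, hq.2⟩ _ (hmem q hq0 w hw), ?_⟩
          rw [mem_ofPred_eq, maxCoord_add_insertNth c _ (hmem q hq0 w hw)]
          linarith [hq.1]
      · intro q hq w hw
        rw [insertNth_add_insertNth]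
        refine indicator_of_notMem (fun h => ?_) _
        have h2 : c + a ≤ _ := h.2
        rw [maxCoord_add_insertNth c _ (hmem q hq.1 w hw)] at h2
        linarith [hq.2]
    · have hc : Continuous fun w : Fin (m + 1) → ℝ =>
          (j.insertNth c ((fun _ => c) + w : Fin (m + 1) → ℝ) : Fin (m + 2) → ℝ) :=
        (continuous_insertNth j c).comp (continuous_const.add continuous_id)
      exact integrableOn_indicator_cube (v := fun w => u (diagonalShift c (j.insertNth c _)))
        (huT.comp hc) (hc.measurable hS)
  simp_rw [hface]
  rw [sum_succAbove_predAbove fun i l =>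
    ∫ q in a..1, cubeIntegral (fun w => topFace u c i (l.insertNth q w)) q]
  exact Finset.sum_congr rfl fun i _ =>
    (cubeIntegral_one_sub_cubeIntegral (continuous_topFace hu c i) ha).symm

theorem restrict_fintype_sum {α ι : Type*} [MeasurableSpace α] [Fintype ι] (μ : ι → Measure α)
    (s : Set α) : (∑ i, μ i).restrict s = ∑ i, (μ i).restrict s := by
  simp only [← Measure.restrictₗ_apply, map_sum]

theorem integral_pushedMeasure {e : ℕ} {u : (Fin (e + 2) → ℝ) → ℝ} (hu : Continuous u)
    {c : ℝ} (hc : 0 ≤ c) {a : ℝ} (ha : a ∈ Ioo (0 : ℝ) 1) :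
    ∫ x in regionB (e + 2) c, u x ∂pushedMeasure (e + 2) c (c + a) =
      ((e : ℝ) + 3) * ∑ i, (∫ q in a..1, cubeIntegral (topFace u c i) q) +
        c * ∑ i, (cubeIntegral (topFace u c i) 1 - cubeIntegral (topFace u c i) a) := by
  have hB : (pushedMeasure (e + 2) c (c + a)).restrict (regionB (e + 2) c) =
      pushedMeasure (e + 2) c (c + a) :=
    Measure.restrict_eq_self_of_ae_mem
      (isPushedMeasure_pushedMeasure (m := e + 1) (by linarith [ha.2])).1
  have hT := continuous_diagonalShift (e + 1) c
  have hint : ∀ μ : Measure (Fin (e + 2) → ℝ), IsFiniteMeasure μ →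
      Integrable (fun y => u (diagonalShift c y)) (μ.restrict (buyers (e + 2) c (c + a))) :=
    fun μ _ => (hu.comp hT).continuousOn.integrableOn_compact (isCompact_buyers (e + 1) c (c + a))
  rw [hB, pushedMeasure, integral_map hT.aemeasurable hu.aestronglyMeasurable,
    muMinus_eq (by omega) hc, negativeMass, Measure.restrict_add, integral_add_measure, restrict_fintype_sum]
  · simp only [Measure.restrict_smul]
    rw [integral_finsetSum_measure]
    · simp only [integral_smul_nnreal_measure]
      rw [setIntegral_buyers_valueLaw hu c ha, ← sum_setIntegral_buyers_faceMeasure hu c ha,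
        ← Finset.smul_sum, NNReal.smul_def, NNReal.smul_def, Real.coe_toNNReal _ hc]
      push_cast
      simp only [smul_eq_mul]
      ring
    · intro i _
      rw [← Measure.restrict_smul]
      exact hint _ inferInstance
  · exact hint _ inferInstance
  · exact hint _ inferInstance

theorem integral_muPlus {e : ℕ} {u : (Fin (e + 2) → ℝ) → ℝ} (hu : Continuous u)
    {c : ℝ} (hc : 0 ≤ c) :
    ∫ x in regionB (e + 2) c, u x ∂muPlus (e + 2) c =
      (c + 1) * ∑ i, cubeIntegral (topFace u c i) 1 := by
  have hBm := measurableSet_regionB (e + 1) c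
  have hdirac : (Measure.dirac (fun _ : Fin (e + 2) => c)).restrict (regionB (e + 2) c) = 0 := by
    rw [Measure.restrict_eq_zero, Measure.dirac_apply' _ hBm, indicator_of_notMem]
    rintro ⟨-, h⟩
    rw [maxCoord, ciSup_const] at h
    linarith
  have hface : ∀ i, (faceMeasure (e + 2) c i (c + 1)).restrict (regionB (e + 2) c) =
      faceMeasure (e + 2) c i (c + 1) := by
    intro i
    refine Measure.restrict_eq_self_of_ae_mem ?_
    filter_upwards [ae_faceMeasure (s := c + 1) ⟨by linarith, le_rfl⟩ i] with x hx
    refine ⟨hx.1, ?_⟩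
    rw [maxCoord_eq_of_isGreatest (i := i) fun j => by rw [hx.2]; exact hx.1.2 j, hx.2]
  have hval : ∀ i, ∫ x, u x ∂faceMeasure (e + 2) c i (c + 1) =
      cubeIntegral (topFace u c i) 1 := by
    intro i
    rw [integral_faceMeasure hu.measurable, ← cubeIntegral_reflect]
    refine setIntegral_congr_fun measurableSet_Icc fun w _ => ?_
    simp only [topFace]
    congr 1
    ext j
    revert j
    refine (Fin.forall_iff_succAbove i).2 ⟨by simp, fun j => ?_⟩
    simp
    ring
  have hint : ∀ i, Integrable u (faceMeasure (e + 2) c i (c + 1)) := by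
    intro i
    have : IntegrableOn u (typeSpace (e + 2) c) (faceMeasure (e + 2) c i (c + 1)) :=
      hu.continuousOn.integrableOn_compact isCompact_Icc
    rwa [IntegrableOn, Measure.restrict_eq_self_of_ae_mem] at this
    filter_upwards [ae_faceMeasure (s := c + 1) ⟨by linarith, le_rfl⟩ i] with x hx using hx.1
  rw [muPlus_eq (by omega) hc, positiveMass, Measure.restrict_add, hdirac, zero_add, restrict_fintype_sum]
  simp only [Measure.restrict_smul, hface]
  rw [integral_finsetSum_measure fun i _ => (hint i).smul_measure_nnreal]
  simp only [integral_smul_nnreal_measure, hval]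
  rw [← Finset.smul_sum, NNReal.smul_def, Real.coe_toNNReal _ (by linarith), smul_eq_mul]

/-! ### Convex dominance and the threshold inequality -/

theorem integral_pushedMeasure_sub_integral_muPlus {e : ℕ} {u : (Fin (e + 2) → ℝ) → ℝ} (hu : Continuous u)
    {c : ℝ} (hc : 0 ≤ c) {a : ℝ} (ha : a ∈ Ioo (0 : ℝ) 1) :
    ∫ x in regionB (e + 2) c, u x ∂pushedMeasure (e + 2) c (c + a) -
        ∫ x in regionB (e + 2) c, u x ∂muPlus (e + 2) c =
      ∑ i, (((e : ℝ) + 3) * (∫ q in a..1, cubeIntegral (topFace u c i) q) -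
        cubeIntegral (topFace u c i) 1 - c * cubeIntegral (topFace u c i) a) := by
  rw [integral_pushedMeasure hu hc ha, integral_muPlus hu hc]
  simp only [Finset.sum_sub_distrib, ← Finset.mul_sum]
  ring

/-- The coordinatewise projection to the type space. -/
noncomputable def clamp {n : ℕ} (c : ℝ) (x : Fin n → ℝ) : Fin n → ℝ :=
  fun i => max c (min (x i) (c + 1))

theorem clamp_mem {n : ℕ} (c : ℝ) (x : Fin n → ℝ) : clamp c x ∈ typeSpace n c :=
  ⟨fun _ => le_max_left _ _, fun _ => max_le (by linarith) (min_le_right _ _)⟩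

theorem clamp_of_mem {n : ℕ} {c : ℝ} {x : Fin n → ℝ} (hx : x ∈ typeSpace n c) : clamp c x = x := by
  ext i
  rw [clamp, min_eq_left (hx.2 i), max_eq_right (hx.1 i)]

theorem continuous_clamp (n : ℕ) (c : ℝ) : Continuous (clamp c : (Fin n → ℝ) → Fin n → ℝ) :=
  continuous_pi fun i => continuous_const.max ((continuous_apply i).min continuous_const)

theorem monotone_clamp (n : ℕ) (c : ℝ) : Monotone (clamp c : (Fin n → ℝ) → Fin n → ℝ) :=
  fun _ _ h i => max_le_max_left _ (min_le_min_right _ (h i))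

theorem antitone_topFace {m : ℕ} {u : (Fin (m + 1) → ℝ) → ℝ} (hu : Monotone u) (c : ℝ)
    (i : Fin (m + 1)) : Antitone (topFace u c i) := fun _ _ h =>
  hu (sub_le_sub_left ((Fin.forall_iff_succAbove i).2 ⟨by simp, fun j => by simpa using h j⟩) _)

/-- Monotonicity of the test function is enough: the pushed measure even dominates the positive part
in the first-order stochastic sense. -/
theorem convexDominatesOn_of_le {e : ℕ} {c a : ℝ} (hc : 0 ≤ c) (ha : a ∈ Ioo (0 : ℝ) 1)
    (hm : margin e c a = 1) (hle : c + 1 ≤ ((e : ℝ) + 3) * (1 - a)) :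
    ConvexDominatesOn (typeSpace (e + 2) c) (regionB (e + 2) c)
      (pushedMeasure (e + 2) c (c + a)) (muPlus (e + 2) c) := by
  rintro u ⟨hcont, hmono, -⟩
  -- Only the values of `u` on the type space matter; replace `u` by a continuous, monotone and
  -- bounded function on the whole space.
  let v : (Fin (e + 2) → ℝ) → ℝ := fun x => u (clamp c x)
  have hv : Continuous v := hcont.comp_continuous (continuous_clamp _ c) (clamp_mem c)
  have hvm : Monotone v := fun x y h =>
    hmono (clamp_mem c x) (clamp_mem c y) (monotone_clamp _ c h)
  have heq : ∀ μ : Measure (Fin (e + 2) → ℝ),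
      ∫ x in regionB (e + 2) c, u x ∂μ = ∫ x in regionB (e + 2) c, v x ∂μ := fun μ =>
    setIntegral_congr_fun (measurableSet_regionB (e + 1) c) fun x hx => by
      simp only [v, clamp_of_mem hx.1]
  obtain ⟨K, hK⟩ := (isCompact_Icc : IsCompact (typeSpace (e + 2) c)).exists_bound_of_continuousOn
    hcont
  rw [ge_iff_le, heq, heq, ← sub_nonneg, integral_pushedMeasure_sub_integral_muPlus hv hc ha]
  refine Finset.sum_nonneg fun i _ => ?_
  have hm' : (((e + 1 : ℕ) : ℝ) + 2) * a ^ (e + 1 + 1) + (((e + 1 : ℕ) : ℝ) + 1) * c * a ^ (e + 1)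
      = 1 := by
    refine Eq.trans ?_ hm
    rw [margin]; push_cast; ring
  have h := cubeIntegral_comparison (continuous_topFace hv c i) (antitone_topFace hvm c i)
    (K := K) (fun w => hK _ (clamp_mem c _)) ha hm' hc (by push_cast; linarith)
  push_cast at h
  linarith

/-- A convex test function supported near the corner `(c + 1, …, c + 1)`. -/
noncomputable def cornerBump (n : ℕ) (c a : ℝ) (x : Fin n → ℝ) : ℝ :=
  max (∑ i, (x i - (c + 1)) + a) 0

theorem continuous_cornerBump (n : ℕ) (c a : ℝ) : Continuous (cornerBump n c a) := by
  unfold cornerBump; fun_prop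

theorem cornerBump_mem_testFunctions (n : ℕ) (c a : ℝ) :
    cornerBump n c a ∈ testFunctions (typeSpace n c) := by
  refine ⟨(continuous_cornerBump n c a).continuousOn, ?_, ?_⟩
  · intro x _ y _ h
    exact max_le_max_right _ (add_le_add_left
      (Finset.sum_le_sum fun i _ => sub_le_sub_right (h i) _) _)
  · refine ConvexOn.sup ?_ (convexOn_const 0 (convex_Icc _ _))
    refine ⟨convex_Icc _ _, fun x _ y _ s t _ _ hst => le_of_eq ?_⟩
    have : ∀ i, (s • x + t • y) i - (c + 1) = s * (x i - (c + 1)) + t * (y i - (c + 1)) := by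
      intro i
      simp only [Pi.add_apply, Pi.smul_apply, smul_eq_mul]
      linear_combination (c + 1) * hst
    simp only [this, Finset.sum_add_distrib, ← Finset.mul_sum, smul_eq_mul]
    linear_combination (-a) * hst

theorem topFace_cornerBump {m : ℕ} (c a : ℝ) (i : Fin (m + 1)) :
    topFace (cornerBump (m + 1) c a) c i = fun w => max (a - ∑ j, w j) 0 := by
  ext w
  simp [topFace, cornerBump, Fin.sum_univ_succAbove _ i]
  ring_nf

/-- On the nonnegative orthant the bump vanishes outside `[0, a] ^ m`. -/
theorem cubeIntegral_bump_eq {m : ℕ} {a q : ℝ} (haq : a ≤ q) :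
    cubeIntegral (fun w : Fin m → ℝ => max (a - ∑ j, w j) 0) q =
      cubeIntegral (fun w : Fin m → ℝ => max (a - ∑ j, w j) 0) a := by
  refine setIntegral_eq_of_subset_of_forall_sdiff_eq_zero measurableSet_Icc (cube_subset haq)
    fun w hw => max_eq_right ?_
  by_contra! hlt
  refine hw.2 ⟨hw.1.1, fun j => ?_⟩
  have : w j ≤ ∑ j, w j := Finset.single_le_sum (fun k _ => hw.1.1 k) (Finset.mem_univ j)
  simp only
  linarith

theorem cubeIntegral_bump_pos {m : ℕ} {a : ℝ} (ha : 0 < a) :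
    0 < cubeIntegral (fun w : Fin m → ℝ => max (a - ∑ j, w j) 0) a := by
  have hcont : Continuous fun w : Fin m → ℝ => max (a - ∑ j, w j) 0 := by fun_prop
  rw [cubeIntegral, setIntegral_pos_iff_support_of_nonneg_ae
    (f := fun w : Fin m → ℝ => max (a - ∑ j, w j) 0)
    (Filter.Eventually.of_forall fun w => le_max_right _ _)
    (hcont.continuousOn.integrableOn_compact isCompact_Icc)]
  have hb : 0 < a / (m + 1) := by positivity
  refine lt_of_lt_of_le ?_ (measure_mono (s := Icc (0 : Fin m → ℝ) fun _ => a / (m + 1)) ?_)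
  · rw [Real.volume_Icc_pi]
    exact pos_iff_ne_zero.2 (Finset.prod_ne_zero_iff.2 fun i _ => by simpa using hb)
  · intro w hw
    have hle : a / (m + 1) ≤ a := div_le_self ha.le (by linarith [(Nat.cast_nonneg m : (0 : ℝ) ≤ m)])
    refine ⟨?_, cube_subset hle hw⟩
    have h1 : ∑ j, w j ≤ ∑ _j : Fin m, a / (m + 1) := Finset.sum_le_sum fun j _ => hw.2 j
    have h2 : ∑ _j : Fin m, a / (m + 1) < a := by
      rw [Finset.sum_const, Finset.card_univ, Fintype.card_fin, nsmul_eq_mul, mul_div_assoc',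
        div_lt_iff₀ (by positivity)]
      linarith
    exact (lt_max_of_lt_left (by linarith)).ne'

theorem le_of_convexDominatesOn {e : ℕ} {c a : ℝ} (hc : 0 ≤ c) (ha : a ∈ Ioo (0 : ℝ) 1)
    (h : ConvexDominatesOn (typeSpace (e + 2) c) (regionB (e + 2) c)
      (pushedMeasure (e + 2) c (c + a)) (muPlus (e + 2) c)) :
    c + 1 ≤ ((e : ℝ) + 3) * (1 - a) := by
  have h1 := h _ (cornerBump_mem_testFunctions (e + 2) c a)
  rw [ge_iff_le, ← sub_nonneg, integral_pushedMeasure_sub_integral_muPlus (continuous_cornerBump _ c a) hc ha] at h1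
  simp only [topFace_cornerBump] at h1
  rw [intervalIntegral.integral_congr fun q hq => cubeIntegral_bump_eq
      (by rw [uIcc_of_le ha.2.le] at hq; exact hq.1), cubeIntegral_bump_eq ha.2.le,
    intervalIntegral.integral_const, Finset.sum_const, Finset.card_univ, Fintype.card_fin,
    nsmul_eq_mul, smul_eq_mul] at h1
  have hpos := cubeIntegral_bump_pos (m := e + 1) ha.1
  set A := cubeIntegral (fun w : Fin (e + 1) → ℝ => max (a - ∑ j, w j) 0) a
  have h2 : 0 ≤ (((e : ℝ) + 3) * (1 - a) - (c + 1)) * A := by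
    have := nonneg_of_mul_nonneg_right h1 (by positivity)
    linarith
  linarith [nonneg_of_mul_nonneg_left h2 hpos]

end UniformPricing

theorem mainTheorem4 (n : ℕ) (hn : 2 ≤ n) :
    (∀ c : ℝ, 0 ≤ c → ∃! p : ℝ, UniformPricing.IsOptimalPrice n c p) ∧
    ∃ cstar : ℝ, (∀ s : ℝ, UniformPricing.IsThreshold n s ↔ s = cstar) ∧
      ∀ c p : ℝ, 0 ≤ c → UniformPricing.IsOptimalPrice n c p →
        ∃ γ₁ : MeasureTheory.Measure (Fin n → ℝ),
          (∀ ν : MeasureTheory.Measure (Fin n → ℝ),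
            UniformPricing.IsPushedMeasure n c p ν ↔ ν = γ₁) ∧
          (UniformPricing.ConvexDominatesOn (UniformPricing.typeSpace n c)
              (UniformPricing.regionB n c) γ₁ (UniformPricing.muPlus n c) ↔
            c ∈ Set.Icc 0 cstar) := by
  obtain ⟨e, rfl⟩ := Nat.exists_eq_add_of_le' hn
  obtain ⟨t, ht, h⟩ := UniformPricing.exists_threshold e
  refine ⟨fun c hc => UniformPricing.existsUnique_isOptimalPrice e hc, t,
    UniformPricing.isThreshold_iff ht h, fun c p hc hp => ?_⟩
  obtain ⟨ha, hm⟩ := (UniformPricing.isOptimalPrice_iff hc).1 hp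
  refine ⟨UniformPricing.pushedMeasure (e + 2) c p,
    UniformPricing.isPushedMeasure_iff (m := e + 1) hp.1.2, ?_⟩
  have hiff := UniformPricing.le_threshold_iff ht h hc ha.1 hm
  rw [← add_sub_cancel c p, Set.mem_Icc, and_iff_right hc, ← hiff]
  exact ⟨UniformPricing.le_of_convexDominatesOn hc ha,
    UniformPricing.convexDominatesOn_of_le hc ha hm⟩
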